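/- Everything is smooth ($C^\infty$) and local: each ODE is considered near a base point of the space $\mathbb{R}^3(x,y,p)$, $p=y'$, and all local diffeomorphisms below take base point to base point. Let $\mathcal E:\ y''^2+A(x,y,y')\,y''+B(x,y,y')=0$ be of hyperbolic type, i.e. $A^2-4B>0$, let $\lambda_1,\lambda_2$ be its roots with respect to $y''$, and let $X_i=\partial_x+p\,\partial_y+\lambda_i\,\partial_p$. Let $\{i,j\}=\{1,2\}$. Let $(a,b)$ be independent integrals of $X_j$ and $(f,g)$ independent integrals of $X_i$ such that $a,b,f$ are independent, write $g=h(a,b,f)$, and suppose $h_b\neq 0$. The functions $a$, $b$, $c=-h_a/h_b$ are called canonical coordinates, and, with $G_i(a,b,c)=-\bigl(h_{aa}h_b^2-2h_ah_bh_{ab}+h_{bb}h_a^2\bigr)/h_b^3$, the ODE $b''=G_i(a,b,b')$ for $b=b(a)$, considered near the point $(a,b,c)$ corresponding to the base point of $\mathcal E$, is called an $i$-th associated ODE of $\mathcal E$. Two ODEs $y''=F(x,y,y')$ are point equivalent if the prolongation of a local diffeomorphism of $\mathbb{R}^2(x,y)$ takes one to the other. Two ODEs $y''^2+Ay''+B=0$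 are contact equivalent if a local contact diffeomorphism of $\mathbb{R}^3(x,y,p)$ (one preserving $dy-p\,dx$ up to a factor) takes one to the other. Theorem 5. Let $\mathcal E$ and $\widetilde{\mathcal E}$ be two ODEs of the form $y''^2+Ay''+B=0$ of hyperbolic type. For $i=1,2$ the $i$-th associated ODEs of $\mathcal E$ exist and, for all choices of integrals, form part of a single point equivalence class $[\mathcal E^a_i]$; likewise $[\widetilde{\mathcal E}^a_i]$ for $\widetilde{\mathcal E}$. The ODEs $\mathcal E$ and $\widetilde{\mathcal E}$ are contact equivalent if and only if $[\mathcal E^a_i]=[\widetilde{\mathcal E}^a_j]$ for some $i,j\in\{1,2\}$. -/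

import Mathlib

open Filter Topology
open scoped ContDiff

noncomputable section

/-- `f` is of class `C^∞` on a neighbourhood of `x`. -/
def SmoothNear {E F : Type*} [NormedAddCommGroup E] [NormedSpace ℝ E]
    [NormedAddCommGroup F] [NormedSpace ℝ F] (f : E → F) (x : E) : Prop :=
  ∀ᶠ y in 𝓝 x, ContDiffAt ℝ ∞ f y

/-- `f` is smooth near `x` and its differential at `x` is invertible, so `f` restricts to a smooth
diffeomorphism from a neighbourhood of `x` onto a neighbourhood of `f x`. -/
def IsLocalDiffeoNear {E F : Type*} [NormedAddCommGroup E] [NormedSpace ℝ E]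
    [NormedAddCommGroup F] [NormedSpace ℝ F] (f : E → F) (x : E) : Prop :=
  SmoothNear f x ∧ Function.Bijective (fderiv ℝ f x)

/-- Partial derivatives of a function of three variables. -/
def pd₁ (h : ℝ × ℝ × ℝ → ℝ) : ℝ × ℝ × ℝ → ℝ := fun u => fderiv ℝ h u (1, 0, 0)

/-- See `pd₁`. -/
def pd₂ (h : ℝ × ℝ × ℝ → ℝ) : ℝ × ℝ × ℝ → ℝ := fun u => fderiv ℝ h u (0, 1, 0)

/-! ### Contact geometry of the space of `(x, y, p)`, `p = y'` -/

/-- The contact form `dy - p dx` at the point `m = (x, y, p)`, evaluated on `v`. -/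
def contactForm (m v : ℝ × ℝ × ℝ) : ℝ := v.2.1 - m.2.2 * v.1

/-- The direction `∂ₓ + p ∂_y + q ∂_p` at `m = (x, y, p)`: the tangent direction at `m` of the
1-jet of a function with second derivative `q`. -/
def jetDirection (m : ℝ × ℝ × ℝ) (q : ℝ) : ℝ × ℝ × ℝ := (1, m.2.2, q)

/-- `φ` is a local contact diffeomorphism near `m₀`: it preserves the contact form up to a
factor. -/
def IsContactNear (φ : ℝ × ℝ × ℝ → ℝ × ℝ × ℝ) (m₀ : ℝ × ℝ × ℝ) : Prop :=
  IsLocalDiffeoNear φ m₀ ∧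
    ∀ᶠ m in 𝓝 m₀, ∃ k : ℝ, ∀ v, contactForm (φ m) (fderiv ℝ φ m v) = k * contactForm m v

/-- A second order ODE is regarded as a relation between `m = (x, y, y')` and `q = y''`. A contact
map `φ` acts on `y''` by the usual prolongation formula `q ↦ (D P) / (D X)`, where
`φ = (X, Y, P)` and `D = ∂ₓ + p ∂_y + q ∂_p`. The definition says that, near `m₀`, the prolonged
map carries the equation `R` to the equation `R'`. -/
def Transforms (φ : ℝ × ℝ × ℝ → ℝ × ℝ × ℝ) (R R' : ℝ × ℝ × ℝ → ℝ → Prop)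
    (m₀ : ℝ × ℝ × ℝ) : Prop :=
  ∀ᶠ m in 𝓝 m₀, ∀ q : ℝ, R m q ↔
    ((fderiv ℝ φ m (jetDirection m q)).1 ≠ 0 ∧
      R' (φ m) ((fderiv ℝ φ m (jetDirection m q)).2.2 / (fderiv ℝ φ m (jetDirection m q)).1))

/-! ### Equations `y'' = F(x, y, y')` and point equivalence -/

/-- An ODE `y'' = F(x, y, y')` with smooth right hand side, near a point of the space of
`(x, y, y')`. -/
structure ExplicitODE where
  /-- the right hand side -/
  F : ℝ × ℝ × ℝ → ℝ
  /-- the point near which the equation is considered -/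
  pt : ℝ × ℝ × ℝ
  smooth : SmoothNear F pt

/-- The equation as a relation between `(x, y, y')` and `y''`. -/
def ExplicitODE.Holds (G : ExplicitODE) (m : ℝ × ℝ × ℝ) (q : ℝ) : Prop := q = G.F m

/-- The prolongation of a point transformation `(x, y) ↦ (X, Y)` to the space of `(x, y, p)`:
`p ↦ (Y_x + p Y_y) / (X_x + p X_y)`. -/
def prolong (ψ : ℝ × ℝ → ℝ × ℝ) (m : ℝ × ℝ × ℝ) : ℝ × ℝ × ℝ :=
  ((ψ (m.1, m.2.1)).1, (ψ (m.1, m.2.1)).2,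
    (fderiv ℝ ψ (m.1, m.2.1) (1, m.2.2)).2 / (fderiv ℝ ψ (m.1, m.2.1) (1, m.2.2)).1)

/-- Local point equivalence: a local diffeomorphism of the plane of `(x, y)`, whose prolongation is
defined at the base point and takes it to the other base point, carries one equation to the
other. -/
def PointEquivalent (G G' : ExplicitODE) : Prop :=
  ∃ ψ : ℝ × ℝ → ℝ × ℝ,
    IsLocalDiffeoNear ψ (G.pt.1, G.pt.2.1) ∧
    (fderiv ℝ ψ (G.pt.1, G.pt.2.1) (1, G.pt.2.2)).1 ≠ 0 ∧
    prolong ψ G.pt = G'.pt ∧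
    Transforms (prolong ψ) G.Holds G'.Holds G.pt

/-- The point equivalence class of an ODE. -/
def pointClass (G : ExplicitODE) : Set ExplicitODE := {G' | PointEquivalent G G'}

/-! ### Equations `y''² + A y'' + B = 0` of hyperbolic type and contact equivalence -/

/-- An ODE `y''² + A(x, y, y') y'' + B(x, y, y') = 0` of hyperbolic type with smooth coefficients,
near a point of the space of `(x, y, y')`. (The discriminant is then positive near that point.) -/
structure HyperbolicODE where
  /-- the coefficient of `y''` -/
  A : ℝ × ℝ × ℝ → ℝ
  /-- the free coefficient -/
  B : ℝ × ℝ × ℝ → ℝ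
  /-- the point near which the equation is considered -/
  pt : ℝ × ℝ × ℝ
  smooth_A : SmoothNear A pt
  smooth_B : SmoothNear B pt
  disc_pos : 0 < A pt ^ 2 - 4 * B pt

/-- The equation as a relation between `(x, y, y')` and `y''`. -/
def HyperbolicODE.Holds (E : HyperbolicODE) (m : ℝ × ℝ × ℝ) (q : ℝ) : Prop :=
  q ^ 2 + E.A m * q + E.B m = 0

/-- The two roots `λ₁`, `λ₂` of the equation with respect to `y''` (indices `0`, `1`). -/
def HyperbolicODE.root (E : HyperbolicODE) (i : Fin 2) (m : ℝ × ℝ × ℝ) : ℝ :=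
  if i = 0 then (-E.A m + Real.sqrt (E.A m ^ 2 - 4 * E.B m)) / 2
  else (-E.A m - Real.sqrt (E.A m ^ 2 - 4 * E.B m)) / 2

/-- Local contact equivalence: a local contact diffeomorphism taking base point to base point
carries one equation to the other. -/
def ContactEquivalent (E E' : HyperbolicODE) : Prop :=
  ∃ φ : ℝ × ℝ × ℝ → ℝ × ℝ × ℝ,
    IsContactNear φ E.pt ∧ φ E.pt = E'.pt ∧ Transforms φ E.Holds E'.Holds E.pt

/-! ### Integrals, canonical coordinates and associated equations -/

/-- `a` is, near `m₀`, an integral of the field `∂ₓ + p ∂_y + λ ∂_p` of the ODE `y'' = λ`. -/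
def IsIntegralOf (lam : ℝ × ℝ × ℝ → ℝ) (a : ℝ × ℝ × ℝ → ℝ) (m₀ : ℝ × ℝ × ℝ) : Prop :=
  SmoothNear a m₀ ∧ ∀ᶠ m in 𝓝 m₀, fderiv ℝ a m (jetDirection m (lam m)) = 0

/-- `Flex h = h_aa h_b² - 2 h_a h_b h_ab + h_bb h_a²` for a function `h` of `(a, b, f)`. -/
def flex (h : ℝ × ℝ × ℝ → ℝ) (u : ℝ × ℝ × ℝ) : ℝ :=
  pd₁ (pd₁ h) u * pd₂ h u ^ 2 - 2 * pd₁ h u * pd₂ h u * pd₂ (pd₁ h) u +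
    pd₂ (pd₂ h) u * pd₁ h u ^ 2

/-- The map `(a, b, f) ↦ (a, b, c)`, `c = - h_a / h_b`, to canonical coordinates. -/
def canonicalCoord (h : ℝ × ℝ × ℝ → ℝ) (u : ℝ × ℝ × ℝ) : ℝ × ℝ × ℝ :=
  (u.1, u.2.1, -(pd₁ h u / pd₂ h u))

/-- Let `(a, b)` be independent integrals of `y'' = lam` and `(f, g)` independent integrals of
`y'' = mu` near `m₀`, such that `a, b, f` are independent, `g = h(a, b, f)` and `h_b ≠ 0`.
Then `(a, b, c)`, `c = - h_a / h_b`, are canonical coordinates, and `b'' = G(a, b, b')`, where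
`G(a, b, c) = - Flex h / h_b³`, is an ODE determined by `mu` and associated with the pair.
It is considered near the point that corresponds to `m₀`. -/
def IsAssociatedWith (lam mu : ℝ × ℝ × ℝ → ℝ) (m₀ : ℝ × ℝ × ℝ) (G : ExplicitODE) : Prop :=
  ∃ a b f g h : ℝ × ℝ × ℝ → ℝ,
    IsIntegralOf lam a m₀ ∧ IsIntegralOf lam b m₀ ∧
    IsIntegralOf mu f m₀ ∧ IsIntegralOf mu g m₀ ∧
    LinearIndependent ℝ ![fderiv ℝ a m₀, fderiv ℝ b m₀, fderiv ℝ f m₀] ∧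
    LinearIndependent ℝ ![fderiv ℝ f m₀, fderiv ℝ g m₀] ∧
    SmoothNear h (a m₀, b m₀, f m₀) ∧
    (∀ᶠ m in 𝓝 m₀, g m = h (a m, b m, f m)) ∧
    pd₂ h (a m₀, b m₀, f m₀) ≠ 0 ∧
    G.pt = canonicalCoord h (a m₀, b m₀, f m₀) ∧
    ∀ᶠ u in 𝓝 (a m₀, b m₀, f m₀), G.F (canonicalCoord h u) = -(flex h u / pd₂ h u ^ 3)

/-- `G` is an ODE `b'' = G_i(a, b, b')` associated with `E` and determined by the `i`-th root:
`(a, b)` are integrals of the other root, `(f, g)` are integrals of the `i`-th one. -/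
def HyperbolicODE.IsAssociated (E : HyperbolicODE) (i : Fin 2) (G : ExplicitODE) : Prop :=
  IsAssociatedWith (E.root i.rev) (E.root i) E.pt G

/-- All ODEs that are point equivalent to an `i`-th associated ODE of `E`, for any choice of the
integrals. -/
def HyperbolicODE.associatedClass (E : HyperbolicODE) (i : Fin 2) : Set ExplicitODE :=
  {G | ∃ G₀, E.IsAssociated i G₀ ∧ PointEquivalent G₀ G}

end

/-!
Everything is expressed through germs of ordered pairs of direction fields. Two such pairs are
equivalent (`PairEquiv`) when a local diffeomorphism carries the directions of the one to those of
the other, in this order; by the inverse function theorem this is an equivalence relation, and it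
is compatible with exchanging the two members of both pairs.

* A hyperbolic equation is the pair of fields `X₀`, `X₁` of its roots. These span the contact
  planes, so a diffeomorphism that respects both directions is automatically a contact map, and a
  contact equivalence respects the directions up to an exchange: `contactEquivalent_iff`.
* An explicit equation `y'' = F` is the pair of the vertical field `∂_p` and the field
  `∂ₓ + p ∂_y + F ∂_p`. A diffeomorphism that preserves the vertical direction covers a map of the
  plane, and the second direction forces it to be the prolongation of that map:
  `pointEquivalent_iff`.
* Canonical coordinates `(a, b, c)` carry the pair `X_j`, `X_i` to the pair of the associated
  equation: `IsAssociatedWith.pairEquiv`. Along `X_j` the functions `a`, `b` are constant, whereas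
  `c` is not, because the contact planes are not integrable
  (`IsCanonicalData.fderiv_third_lam_ne_zero`); along `X_i` one has `db = c da`, and the derivative
  of `c = - h_a / h_b` yields the right hand side `- Flex h / h_b³`.

Hence the class of the `i`-th associated equation consists of the equations whose pair is
equivalent to `(X_j, X_i)`, and equality of two classes is equivalence of the underlying pairs.

It remains to show that associated equations exist, that is, that `X_i` has two independent smooth
integrals. They are the initial values, on the plane `x = x₀`, of the integral curve through a given
point (`exists_integrals`). Their smoothness is the smooth dependence of flows on the initial
point, which is obtained from the inverse function theorem in the Banach space of continuous paths:
the integral equation `γ = m + ε ∫ X(γ)` depends smoothly on `m`, `ε`, `γ`, since composition with a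
smooth function of compact support is a smooth operator (`contDiff_comp_left`), and at `ε = 0` its
derivative in `γ` is the identity.
-/

noncomputable section

/-! ### Germs of smooth maps and the inverse function theorem -/

section SmoothMaps

variable {E F G : Type*} [NormedAddCommGroup E] [NormedSpace ℝ E]
  [NormedAddCommGroup F] [NormedSpace ℝ F] [NormedAddCommGroup G] [NormedSpace ℝ G]

theorem SmoothNear.contDiffAt {f : E → F} {x : E} (hf : SmoothNear f x) : ContDiffAt ℝ ∞ f x :=
  hf.self_of_nhds

theorem SmoothNear.differentiableAt {f : E → F} {x : E} (hf : SmoothNear f x) :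
    DifferentiableAt ℝ f x :=
  hf.contDiffAt.differentiableAt (by simp)

theorem SmoothNear.continuousAt {f : E → F} {x : E} (hf : SmoothNear f x) : ContinuousAt f x :=
  hf.contDiffAt.continuousAt

theorem SmoothNear.eventually {f : E → F} {x : E} (hf : SmoothNear f x) :
    ∀ᶠ y in 𝓝 x, SmoothNear f y :=
  eventually_eventually_nhds.2 hf

theorem SmoothNear.congr {f g : E → F} {x : E} (hf : SmoothNear f x) (h : g =ᶠ[𝓝 x] f) :
    SmoothNear g x := by
  filter_upwards [hf, h.eventuallyEq_nhds] with y hy hgf using hy.congr_of_eventuallyEq hgf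

theorem ContDiff.smoothNear {f : E → F} (hf : ContDiff ℝ ∞ f) (x : E) : SmoothNear f x :=
  Eventually.of_forall fun _ => hf.contDiffAt

theorem SmoothNear.comp {g : F → G} {f : E → F} {x : E} (hg : SmoothNear g (f x))
    (hf : SmoothNear f x) : SmoothNear (fun y => g (f y)) x := by
  filter_upwards [hf, hf.continuousAt.eventually hg] with y hy hgy using hgy.comp y hy

theorem SmoothNear.prodMk {f : E → F} {g : E → G} {x : E} (hf : SmoothNear f x)
    (hg : SmoothNear g x) : SmoothNear (fun y => (f y, g y)) x := by
  filter_upwards [hf, hg] with y hfy hgy using hfy.prodMk hgy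

theorem SmoothNear.fst {f : E → F × G} {x : E} (hf : SmoothNear f x) :
    SmoothNear (fun y => (f y).1) x := by
  filter_upwards [hf] with y hfy using hfy.fst

theorem SmoothNear.snd {f : E → F × G} {x : E} (hf : SmoothNear f x) :
    SmoothNear (fun y => (f y).2) x := by
  filter_upwards [hf] with y hfy using hfy.snd

theorem SmoothNear.div {f g : E → ℝ} {x : E} (hf : SmoothNear f x) (hg : SmoothNear g x)
    (h0 : g x ≠ 0) : SmoothNear (fun y => f y / g y) x := by
  filter_upwards [hf, hg, hg.continuousAt.eventually_ne h0] with y hfy hgy h0y using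
    hfy.div hgy h0y

theorem SmoothNear.fderiv_apply {f : E → F} {V : E → E} {x : E} (hf : SmoothNear f x)
    (hV : SmoothNear V x) : SmoothNear (fun y => fderiv ℝ f y (V y)) x := by
  filter_upwards [hf, hV] with y hfy hVy
  exact (hfy.fderiv_right (m := ∞) le_rfl).clm_apply hVy

theorem IsLocalDiffeoNear.exists_equiv [CompleteSpace E] [CompleteSpace F] {f : E → F} {x : E}
    (hf : IsLocalDiffeoNear f x) : ∃ e : E ≃L[ℝ] F, (e : E →L[ℝ] F) = fderiv ℝ f x :=
  ⟨ContinuousLinearEquiv.ofBijective (fderiv ℝ f x) (LinearMap.ker_eq_bot.2 hf.2.1)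
    (LinearMap.range_eq_top.2 hf.2.2), rfl⟩

theorem IsLocalDiffeoNear.eventually [CompleteSpace E] [CompleteSpace F] {f : E → F} {x : E}
    (hf : IsLocalDiffeoNear f x) : ∀ᶠ y in 𝓝 x, IsLocalDiffeoNear f y := by
  obtain ⟨e, he⟩ := hf.exists_equiv
  have hc : ContinuousAt (fderiv ℝ f) x :=
    (hf.1.contDiffAt.fderiv_right (m := 0) (by simp)).continuousAt
  have hmem : ∀ᶠ y in 𝓝 x, fderiv ℝ f y ∈ Set.range ((↑) : (E ≃L[ℝ] F) → E →L[ℝ] F) :=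
    hc (he ▸ ContinuousLinearEquiv.nhds e)
  filter_upwards [hf.1.eventually, hmem] with y hy hey
  obtain ⟨e', he'⟩ := hey
  exact ⟨hy, he' ▸ e'.bijective⟩

theorem IsLocalDiffeoNear.comp {g : F → G} {f : E → F} {x : E} (hg : IsLocalDiffeoNear g (f x))
    (hf : IsLocalDiffeoNear f x) : IsLocalDiffeoNear (fun y => g (f y)) x := by
  refine ⟨hg.1.comp hf.1, ?_⟩
  rw [fderiv_fun_comp x hg.1.differentiableAt hf.1.differentiableAt]
  exact hg.2.comp hf.2

/-- The inverse function theorem, for maps that are smooth on a neighbourhood. -/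
theorem IsLocalDiffeoNear.exists_inverse [CompleteSpace E] [CompleteSpace F] {f : E → F} {x : E}
    (hf : IsLocalDiffeoNear f x) :
    ∃ g : F → E, IsLocalDiffeoNear g (f x) ∧ g (f x) = x ∧
      (∀ᶠ y in 𝓝 (f x), f (g y) = y) ∧ ∀ᶠ z in 𝓝 x, g (f z) = z := by
  obtain ⟨e, he⟩ := hf.exists_equiv
  have hd : HasFDerivAt f (e : E →L[ℝ] F) x := he ▸ hf.1.differentiableAt.hasFDerivAt
  have hn : (∞ : WithTop ℕ∞) ≠ 0 := by simp
  have hstrict := hf.1.contDiffAt.hasStrictFDerivAt' hd hn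
  set g := hstrict.localInverse f e x with hg
  have hgx : g (f x) = x := hstrict.localInverse_apply_image
  have hfg : ∀ᶠ y in 𝓝 (f x), f (g y) = y := hstrict.eventually_right_inverse
  have hgf : ∀ᶠ z in 𝓝 x, g (f z) = z := hstrict.eventually_left_inverse
  have hgc : Tendsto g (𝓝 (f x)) (𝓝 x) := hstrict.localInverse_tendsto
  have hsm : SmoothNear g (f x) := by
    let H := hf.1.contDiffAt.toOpenPartialHomeomorph f hd hn
    have hmem : ∀ᶠ y in 𝓝 (f x), y ∈ H.target :=
      H.open_target.mem_nhds (hf.1.contDiffAt.image_mem_toOpenPartialHomeomorph_target hd hn)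
    filter_upwards [hmem, hgc.eventually hf.eventually] with y hy hfy
    obtain ⟨e', he'⟩ := hfy.exists_equiv
    exact H.contDiffAt_symm hy (he' ▸ hfy.1.differentiableAt.hasFDerivAt) hfy.1.contDiffAt
  refine ⟨g, ⟨hsm, ?_⟩, hgx, hfg, hgf⟩
  have hcomp : (fderiv ℝ g (f x)).comp (e : E →L[ℝ] F) = ContinuousLinearMap.id ℝ E := by
    rw [he, ← fderiv_comp x hsm.differentiableAt hf.1.differentiableAt,
      ← fderiv_id (𝕜 := ℝ) (x := x)]
    exact EventuallyEq.fderiv_eq hgf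
  have : fderiv ℝ g (f x) = (e.symm : F →L[ℝ] E) := by
    ext v
    simpa using DFunLike.congr_fun hcomp (e.symm v)
  rw [this]
  exact e.symm.bijective

end SmoothMaps

/-! ### Pairs of direction fields -/

/-- `φ` carries the direction field spanned by `V` to the one spanned by `V'` near `x`: the image
of `V` is a nowhere zero multiple of `V'`. -/
def MapsDirection {E F : Type*} [NormedAddCommGroup E] [NormedSpace ℝ E] [NormedAddCommGroup F]
    [NormedSpace ℝ F] (φ : E → F) (V : E → E) (V' : F → F) (x : E) : Prop :=
  ∀ᶠ m in 𝓝 x, ∃ k : ℝ, k ≠ 0 ∧ fderiv ℝ φ m (V m) = k • V' (φ m)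

/-- Equivalence of germs of ordered pairs of direction fields: a local diffeomorphism from a
neighbourhood of `x` to a neighbourhood of `y` carries the directions of `V`, `W` to those of
`V'`, `W'`. -/
def PairEquiv {E F : Type*} [NormedAddCommGroup E] [NormedSpace ℝ E] [NormedAddCommGroup F]
    [NormedSpace ℝ F] (V W : E → E) (x : E) (V' W' : F → F) (y : F) : Prop :=
  ∃ φ : E → F, IsLocalDiffeoNear φ x ∧ φ x = y ∧ MapsDirection φ V V' x ∧ MapsDirection φ W W' x

section PairEquiv

variable {E F G : Type*} [NormedAddCommGroup E] [NormedSpace ℝ E]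
  [NormedAddCommGroup F] [NormedSpace ℝ F] [NormedAddCommGroup G] [NormedSpace ℝ G]

theorem MapsDirection.comp {φ : E → F} {ψ : F → G} {U : E → E} {V : F → F} {W : G → G} {x : E}
    (hψ : MapsDirection ψ V W (φ x)) (hφ : MapsDirection φ U V x) (hψs : SmoothNear ψ (φ x))
    (hφs : SmoothNear φ x) : MapsDirection (fun m => ψ (φ m)) U W x := by
  filter_upwards [hφ, hφs.continuousAt.eventually hψ, hφs, hφs.continuousAt.eventually hψs]
    with m ⟨k, hk, hkm⟩ ⟨l, hl, hlm⟩ hs hs'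
  refine ⟨k * l, mul_ne_zero hk hl, ?_⟩
  rw [fderiv_fun_comp m (hs'.differentiableAt (by simp)) (hs.differentiableAt (by simp))]
  simp [hkm, hlm, mul_smul]

theorem MapsDirection.inverse {φ : E → F} {ψ : F → E} {V : E → E} {V' : F → F} {x : E}
    (h : MapsDirection φ V V' x) (hφ : SmoothNear φ x) (hψ : SmoothNear ψ (φ x)) (hx : ψ (φ x) = x)
    (hr : ∀ᶠ y in 𝓝 (φ x), φ (ψ y) = y) (hl : ∀ᶠ z in 𝓝 x, ψ (φ z) = z) :
    MapsDirection ψ V' V (φ x) := by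
  have ht : Tendsto ψ (𝓝 (φ x)) (𝓝 x) := by simpa only [ContinuousAt, hx] using hψ.continuousAt
  have key : ∀ᶠ z in 𝓝 x, ∃ k : ℝ, k ≠ 0 ∧ fderiv ℝ ψ (φ z) (V' (φ z)) = k • V z := by
    filter_upwards [h, hφ, hφ.continuousAt.eventually hψ, eventually_eventually_nhds.2 hl]
      with z ⟨k, hk, hkz⟩ hs hs' hlz
    have hid : fderiv ℝ (fun z => ψ (φ z)) z = ContinuousLinearMap.id ℝ E := by
      rw [← fderiv_id (𝕜 := ℝ) (x := z)]
      exact EventuallyEq.fderiv_eq hlz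
    rw [fderiv_fun_comp z (hs'.differentiableAt (by simp)) (hs.differentiableAt (by simp))] at hid
    have hV := DFunLike.congr_fun hid (V z)
    simp only [ContinuousLinearMap.comp_apply, hkz, map_smul, ContinuousLinearMap.id_apply] at hV
    refine ⟨k⁻¹, inv_ne_zero hk, ?_⟩
    rw [← hV, smul_smul, inv_mul_cancel₀ hk, one_smul]
  filter_upwards [ht.eventually key, hr] with y hy hry
  rwa [hry] at hy

variable {V W : E → E} {x : E} {V' W' : F → F} {y : F} {V'' W'' : G → G} {z : G}

theorem PairEquiv.symm [CompleteSpace E] [CompleteSpace F] (h : PairEquiv V W x V' W' y) :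
    PairEquiv V' W' y V W x := by
  obtain ⟨φ, hφ, rfl, hV, hW⟩ := h
  obtain ⟨ψ, hψ, hx, hr, hl⟩ := hφ.exists_inverse
  exact ⟨ψ, hψ, hx, hV.inverse hφ.1 hψ.1 hx hr hl, hW.inverse hφ.1 hψ.1 hx hr hl⟩

theorem PairEquiv.trans (h : PairEquiv V W x V' W' y) (h' : PairEquiv V' W' y V'' W'' z) :
    PairEquiv V W x V'' W'' z := by
  obtain ⟨φ, hφ, rfl, hV, hW⟩ := h
  obtain ⟨ψ, hψ, rfl, hV', hW'⟩ := h'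
  exact ⟨fun m => ψ (φ m), hψ.comp hφ, rfl, hV'.comp hV hψ.1 hφ.1, hW'.comp hW hψ.1 hφ.1⟩

theorem PairEquiv.swap (h : PairEquiv V W x V' W' y) : PairEquiv W V x W' V' y := by
  obtain ⟨φ, hφ, hx, hV, hW⟩ := h
  exact ⟨φ, hφ, hx, hW, hV⟩

end PairEquiv

/-! ### Contact equivalence of hyperbolic equations -/

/-- The field `∂ₓ + p ∂_y + λ ∂_p` of the ODE `y'' = λ`. -/
def jetField (lam : ℝ × ℝ × ℝ → ℝ) (m : ℝ × ℝ × ℝ) : ℝ × ℝ × ℝ := jetDirection m (lam m)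

theorem SmoothNear.jetField {lam : ℝ × ℝ × ℝ → ℝ} {m₀ : ℝ × ℝ × ℝ} (h : SmoothNear lam m₀) :
    SmoothNear (jetField lam) m₀ := by
  filter_upwards [h] with m hm
  exact contDiffAt_const.prodMk (contDiffAt_snd.snd.prodMk hm)

theorem contactForm_jetDirection (m : ℝ × ℝ × ℝ) (q : ℝ) :
    contactForm m (jetDirection m q) = 0 := by
  simp [contactForm, jetDirection]

theorem contactForm_smul (m : ℝ × ℝ × ℝ) (k : ℝ) (v : ℝ × ℝ × ℝ) :
    contactForm m (k • v) = k * contactForm m v := by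
  simp only [contactForm, Prod.smul_fst, Prod.smul_snd, smul_eq_mul]; ring

/-- A vector of the contact plane with nonzero first component is a multiple of a jet direction. -/
theorem eq_smul_jetDirection {m w : ℝ × ℝ × ℝ} (hw : contactForm m w = 0) (h1 : w.1 ≠ 0) :
    w = w.1 • jetDirection m (w.2.2 / w.1) := by
  obtain ⟨a, b, c⟩ := w
  simp only [contactForm, jetDirection] at *
  ext <;> simp
  · linarith
  · field_simp

/-- Two distinct jet directions span the contact plane, so a linear map sending both into a contact
plane pulls the contact form back to a multiple of the contact form. -/
theorem exists_contactForm_comp_eq (L : ℝ × ℝ × ℝ →L[ℝ] ℝ × ℝ × ℝ) {m m' : ℝ × ℝ × ℝ} {q r : ℝ}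
    (hqr : q ≠ r) (hq : contactForm m' (L (jetDirection m q)) = 0)
    (hr : contactForm m' (L (jetDirection m r)) = 0) :
    ∃ k : ℝ, ∀ v, contactForm m' (L v) = k * contactForm m v := by
  refine ⟨contactForm m' (L (0, 1, 0)), fun v => ?_⟩
  have hne : r - q ≠ 0 := sub_ne_zero.2 hqr.symm
  have hv : v = (v.1 - (v.2.2 - q * v.1) / (r - q)) • jetDirection m q +
      ((v.2.2 - q * v.1) / (r - q)) • jetDirection m r +
      contactForm m v • ((0, 1, 0) : ℝ × ℝ × ℝ) := by
    obtain ⟨a, b, c⟩ := v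
    ext <;> simp [jetDirection, contactForm] <;> field_simp <;> ring
  have hadd : ∀ u w, contactForm m' (u + w) = contactForm m' u + contactForm m' w := fun u w => by
    simp only [contactForm, Prod.fst_add, Prod.snd_add]; ring
  conv_lhs => rw [hv]
  rw [map_add, map_add, map_smul, map_smul, map_smul, hadd, hadd, contactForm_smul,
    contactForm_smul, contactForm_smul, hq, hr]
  ring

namespace HyperbolicODE

theorem eventually_disc_pos (E : HyperbolicODE) :
    ∀ᶠ m in 𝓝 E.pt, 0 < E.A m ^ 2 - 4 * E.B m :=
  (((E.smooth_A.continuousAt.pow 2).sub (E.smooth_B.continuousAt.const_mul 4))).eventually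
    (lt_mem_nhds E.disc_pos)

theorem smoothNear_root (E : HyperbolicODE) (i : Fin 2) : SmoothNear (E.root i) E.pt := by
  filter_upwards [E.smooth_A, E.smooth_B, E.eventually_disc_pos] with m hA hB hm
  have hs : ContDiffAt ℝ ∞ (fun m => Real.sqrt (E.A m ^ 2 - 4 * E.B m)) m :=
    ((hA.pow 2).sub (contDiffAt_const.mul hB)).sqrt hm.ne'
  unfold root
  split_ifs
  · exact (hA.neg.add hs).div_const 2
  · exact (hA.neg.sub hs).div_const 2

theorem eventually_root_ne (E : HyperbolicODE) (i : Fin 2) :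
    ∀ᶠ m in 𝓝 E.pt, E.root i m ≠ E.root i.rev m := by
  filter_upwards [E.eventually_disc_pos] with m hm
  have := Real.sqrt_pos.2 hm
  fin_cases i <;> simp [root] <;> intro h <;> linarith

theorem eventually_holds_iff (E : HyperbolicODE) (i : Fin 2) :
    ∀ᶠ m in 𝓝 E.pt, ∀ q, E.Holds m q ↔ q = E.root i m ∨ q = E.root i.rev m := by
  filter_upwards [E.eventually_disc_pos] with m hm q
  have hs := Real.sq_sqrt hm.le
  have hfac : q ^ 2 + E.A m * q + E.B m = (q - E.root 0 m) * (q - E.root 1 m) := by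
    simp only [root, if_true, one_ne_zero, if_false]
    linear_combination hs / 4
  rw [Holds, hfac, mul_eq_zero, sub_eq_zero, sub_eq_zero]
  fin_cases i <;> simp [or_comm]

/-- The direction field of the `i`-th root. -/
def field (E : HyperbolicODE) (i : Fin 2) : ℝ × ℝ × ℝ → ℝ × ℝ × ℝ := jetField (E.root i)

end HyperbolicODE

open HyperbolicODE in
/-- A contact equivalence maps the roots to roots and, the two roots being distinct, it does so with
a labelling that is constant near the base point. Conversely, the two fields span the contact
planes, so a diffeomorphism that respects both directions is a contact map. -/
theorem contactEquivalent_iff (E E' : HyperbolicODE) :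
    ContactEquivalent E E' ↔
      ∃ j : Fin 2, PairEquiv (E.field 0) (E.field 1) E.pt (E'.field j) (E'.field j.rev) E'.pt := by
  constructor
  · rintro ⟨φ, ⟨hφ, hcon⟩, hpt, htr⟩
    have hcφ : Tendsto φ (𝓝 E.pt) (𝓝 E'.pt) := hpt ▸ hφ.1.continuousAt
    -- the value of the second derivative to which `φ` carries the `i`-th root
    let r : Fin 2 → ℝ × ℝ × ℝ → ℝ := fun i m =>
      (fderiv ℝ φ m (E.field i m)).2.2 / (fderiv ℝ φ m (E.field i m)).1
    have hroot : ∀ i : Fin 2, ∀ᶠ m in 𝓝 E.pt, (fderiv ℝ φ m (E.field i m)).1 ≠ 0 ∧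
        E'.Holds (φ m) (r i m) ∧ fderiv ℝ φ m (E.field i m) =
          (fderiv ℝ φ m (E.field i m)).1 • jetDirection (φ m) (r i m) := by
      intro i
      filter_upwards [hcon, htr, E.eventually_holds_iff i] with m ⟨k, hk⟩ hm hE
      obtain ⟨h1, h2⟩ := (hm _).1 ((hE (E.root i m)).2 (Or.inl rfl))
      refine ⟨h1, h2, eq_smul_jetDirection ?_ h1⟩
      rw [hk, field, jetField, contactForm_jetDirection, mul_zero]
    have hr_ne : ∀ᶠ m in 𝓝 E.pt, r 0 m ≠ r 1 m := by
      filter_upwards [hφ.eventually, hroot 0, hroot 1, E.eventually_root_ne 0]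
        with m hm ⟨h0, _, e0⟩ ⟨h1, _, e1⟩ hne heq
      set a := (fderiv ℝ φ m (E.field 0 m)).1
      set b := (fderiv ℝ φ m (E.field 1 m)).1
      have : fderiv ℝ φ m (b • E.field 0 m) = fderiv ℝ φ m (a • E.field 1 m) := by
        rw [map_smul, map_smul, e0, e1, heq, smul_comm]
      have hv := hm.2.1 this
      simp only [field, jetField, jetDirection, Prod.smul_mk, smul_eq_mul, mul_one,
        Prod.mk.injEq] at hv
      rw [hv.1] at hv
      exact hne (mul_left_cancel₀ h0 hv.2.2)
    have hrc : ContinuousAt (r 0) E.pt := by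
      have := hφ.1.fderiv_apply (E.smoothNear_root 0).jetField
      exact (this.snd.snd.div this.fst (hroot 0).self_of_nhds.1).continuousAt
    obtain ⟨j, hj⟩ : ∃ j : Fin 2, r 0 E.pt = E'.root j E'.pt := by
      have := ((E'.eventually_holds_iff 0).self_of_nhds (r 0 E.pt)).1
        (hpt ▸ (hroot 0).self_of_nhds.2.1)
      rcases this with h | h
      exacts [⟨0, h⟩, ⟨Fin.rev 0, h⟩]
    have hne : ∀ᶠ m in 𝓝 E.pt, r 0 m ≠ E'.root j.rev (φ m) := by
      have hc' : ContinuousAt (fun m => E'.root j.rev (φ m)) E.pt :=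
        ContinuousAt.comp (g := E'.root j.rev) (f := φ) 
          (hpt ▸ (E'.smoothNear_root j.rev).continuousAt) hφ.1.continuousAt
      refine hrc.ne_iff_eventually_ne hc' |>.1 ?_
      rw [hj, hpt]
      exact (E'.eventually_root_ne j).self_of_nhds
    have hlab : ∀ᶠ m in 𝓝 E.pt, r 0 m = E'.root j (φ m) ∧ r 1 m = E'.root j.rev (φ m) := by
      filter_upwards [hne, hr_ne, hroot 0, hroot 1, hcφ.eventually (E'.eventually_holds_iff j)]
        with m h1 h2 h3 h4 h5
      have h0 := ((h5 _).1 h3.2.1).resolve_right h1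
      exact ⟨h0, ((h5 _).1 h4.2.1).resolve_left fun h => h2 (h0.trans h.symm)⟩
    refine ⟨j, φ, hφ, hpt, ?_, ?_⟩
    · filter_upwards [hroot 0, hlab] with m h0 hl
      exact ⟨_, h0.1, by simpa only [field, jetField, hl.1] using h0.2.2⟩
    · filter_upwards [hroot 1, hlab] with m h0 hl
      exact ⟨_, h0.1, by simpa only [field, jetField, hl.2] using h0.2.2⟩
  · rintro ⟨j, φ, hφ, hpt, hV, hW⟩
    have hcφ : Tendsto φ (𝓝 E.pt) (𝓝 E'.pt) := hpt ▸ hφ.1.continuousAt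
    have hcon : ∀ᶠ m in 𝓝 E.pt,
        ∃ k : ℝ, ∀ v, contactForm (φ m) (fderiv ℝ φ m v) = k * contactForm m v := by
      filter_upwards [hV, hW, E.eventually_root_ne 0] with m ⟨k, _, hk⟩ ⟨l, _, hl⟩ hne
      refine exists_contactForm_comp_eq _ hne (?_ : contactForm _ (fderiv ℝ φ m (E.field 0 m)) = 0)
        (?_ : contactForm _ (fderiv ℝ φ m (E.field 1 m)) = 0)
      · rw [hk, contactForm_smul, field, jetField, contactForm_jetDirection, mul_zero]
      · rw [hl, contactForm_smul, field, jetField, contactForm_jetDirection, mul_zero]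
    refine ⟨φ, ⟨hφ, hcon⟩, hpt, ?_⟩
    filter_upwards [hcon, hφ.eventually, hV, hW, E.eventually_holds_iff 0,
      hcφ.eventually (E'.eventually_holds_iff j)]
      with m ⟨c, hc⟩ hm ⟨k, hk0, hk⟩ ⟨l, hl0, hl⟩ hE hE' q
    rw [hE, hE']
    constructor
    · rintro (rfl | rfl)
      · rw [field, jetField] at hk
        rw [hk]; simp [field, jetField, jetDirection, hk0]
      · rw [field, jetField] at hl
        rw [show Fin.rev (0 : Fin 2) = 1 from rfl, hl]; simp [field, jetField, jetDirection, hl0]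
    · rintro ⟨h1, h2⟩
      have hw := eq_smul_jetDirection
        (by rw [hc, contactForm_jetDirection, mul_zero]) h1
      -- a jet direction whose image is parallel to that of a root is the direction of the root
      have back : ∀ (i : Fin 2) (s t : ℝ), t ≠ 0 →
          fderiv ℝ φ m (E.field i m) = t • jetDirection (φ m) s →
          (fderiv ℝ φ m (jetDirection m q)).2.2 / (fderiv ℝ φ m (jetDirection m q)).1 = s →
          q = E.root i m := by
        intro i s t ht hi hs
        rw [hs] at hw
        set a := (fderiv ℝ φ m (jetDirection m q)).1
        have : fderiv ℝ φ m (t • jetDirection m q) = fderiv ℝ φ m (a • E.field i m) := by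
          rw [map_smul, map_smul, hw, hi, smul_comm]
        have hv := hm.2.1 this
        simp only [field, jetField, jetDirection, Prod.smul_mk, smul_eq_mul, mul_one,
          Prod.mk.injEq] at hv
        rw [hv.1] at hv
        exact mul_left_cancel₀ h1 hv.2.2
      rcases h2 with h2 | h2
      · exact Or.inl (back 0 _ k hk0 hk h2)
      · exact Or.inr (back 1 _ l hl0 hl h2)

/-! ### Point transformations as maps preserving the vertical direction -/

/-- The projection `(x, y, p) ↦ (x, y)`. -/
def planeProj : ℝ × ℝ × ℝ →L[ℝ] ℝ × ℝ :=
  (ContinuousLinearMap.fst ℝ ℝ (ℝ × ℝ)).prod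
    ((ContinuousLinearMap.fst ℝ ℝ ℝ).comp (ContinuousLinearMap.snd ℝ ℝ (ℝ × ℝ)))

theorem planeProj_apply (m : ℝ × ℝ × ℝ) : planeProj m = (m.1, m.2.1) := rfl

/-- The field `∂_p`, spanning the fibres of `planeProj`. -/
def verticalField (_ : ℝ × ℝ × ℝ) : ℝ × ℝ × ℝ := (0, 0, 1)

theorem jetDirection_eq_add (m : ℝ × ℝ × ℝ) (q r : ℝ) :
    jetDirection m q = jetDirection m r + (q - r) • verticalField m := by
  ext <;> simp [jetDirection, verticalField]

theorem planeProj_fderiv {φ : ℝ × ℝ × ℝ → ℝ × ℝ × ℝ} {ψ : ℝ × ℝ → ℝ × ℝ} {m : ℝ × ℝ × ℝ}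
    (h : ∀ᶠ z in 𝓝 m, planeProj (φ z) = ψ (planeProj z)) (hφ : DifferentiableAt ℝ φ m)
    (hψ : DifferentiableAt ℝ ψ (planeProj m)) (v : ℝ × ℝ × ℝ) :
    planeProj (fderiv ℝ φ m v) = fderiv ℝ ψ (planeProj m) (planeProj v) := by
  have h1 : HasFDerivAt (fun z => planeProj (φ z)) (planeProj.comp (fderiv ℝ φ m)) m :=
    planeProj.hasFDerivAt.comp m hφ.hasFDerivAt
  have h2 : HasFDerivAt (fun z => ψ (planeProj z)) ((fderiv ℝ ψ (planeProj m)).comp planeProj) m :=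
    hψ.hasFDerivAt.comp m planeProj.hasFDerivAt
  exact DFunLike.congr_fun (h1.unique (h2.congr_of_eventuallyEq h)) v

theorem tendsto_planeProj (m : ℝ × ℝ × ℝ) : Tendsto planeProj (𝓝 m) (𝓝 (planeProj m)) :=
  planeProj.continuous.continuousAt

theorem smoothNear_prolong {ψ : ℝ × ℝ → ℝ × ℝ} {m : ℝ × ℝ × ℝ}
    (hψ : SmoothNear ψ (planeProj m)) (h0 : (fderiv ℝ ψ (planeProj m) (1, m.2.2)).1 ≠ 0) :
    SmoothNear (prolong ψ) m := by
  have hψp : SmoothNear (fun z => ψ (planeProj z)) m :=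
    hψ.comp (planeProj.contDiff.smoothNear m)
  have hD : SmoothNear (fun z : ℝ × ℝ × ℝ => fderiv ℝ ψ (planeProj z) (1, z.2.2)) m := by
    filter_upwards [(tendsto_planeProj m).eventually hψ] with z hz
    have h1 : ContDiffAt ℝ ∞ (fun z => fderiv ℝ ψ (planeProj z)) z :=
      (hz.fderiv_right (m := ∞) le_rfl).comp z planeProj.contDiff.contDiffAt
    exact h1.clm_apply (contDiffAt_const.prodMk contDiffAt_snd.snd)
  exact hψp.fst.prodMk (hψp.snd.prodMk (hD.snd.div hD.fst h0))

/-- The prolongation of a plane diffeomorphism acts on the slope by a fractional linear map, whose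
derivative is the Jacobian divided by a square. -/
theorem exists_fderiv_prolong_vertical {ψ : ℝ × ℝ → ℝ × ℝ} {m : ℝ × ℝ × ℝ}
    (hψ : IsLocalDiffeoNear ψ (planeProj m))
    (h0 : (fderiv ℝ ψ (planeProj m) (1, m.2.2)).1 ≠ 0) :
    ∃ k : ℝ, k ≠ 0 ∧
      fderiv ℝ (prolong ψ) m (verticalField m) = k • verticalField (prolong ψ m) := by
  have hφ := smoothNear_prolong hψ.1 h0
  set u := fderiv ℝ ψ (planeProj m) (1, 0) with hu
  set w := fderiv ℝ ψ (planeProj m) (0, 1) with hw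
  have hlin : ∀ p : ℝ, fderiv ℝ ψ (planeProj m) (1, p) = u + p • w := fun p => by
    rw [hu, hw, ← map_smul, ← map_add]; congr 1; simp
  have hJ : w.2 * u.1 - u.2 * w.1 ≠ 0 := by
    intro hJ
    have h : fderiv ℝ ψ (planeProj m) (w.1 • (1, 0) - u.1 • (0, 1)) = 0 := by
      rw [map_sub, map_smul, map_smul, ← hu, ← hw]
      ext <;> simp <;> linarith
    have h' := (injective_iff_map_eq_zero _).1 hψ.2.1 _ h
    simp at h'
    rw [hlin] at h0
    simp [h'.1, h'.2] at h0
  have hp0 : u.1 + m.2.2 * w.1 ≠ 0 := by simpa [hlin] using h0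
  have hproj := planeProj_fderiv (φ := prolong ψ) (ψ := ψ) (m := m)
    (Eventually.of_forall fun z => rfl) hφ.differentiableAt hψ.1.differentiableAt (verticalField m)
  have hline : HasDerivAt (fun t : ℝ => (m.1, m.2.1, t)) (verticalField m) m.2.2 :=
    (hasDerivAt_const _ _).prodMk ((hasDerivAt_const _ _).prodMk (hasDerivAt_id _))
  have hcurve : HasDerivAt (fun t : ℝ => (prolong ψ (m.1, m.2.1, t)).2.2)
      (fderiv ℝ (prolong ψ) m (verticalField m)).2.2 m.2.2 :=
    HasFDerivAt.comp_hasDerivAt (l := fun w : ℝ × ℝ × ℝ => w.2.2) m.2.2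
      ((ContinuousLinearMap.snd ℝ ℝ ℝ).comp (ContinuousLinearMap.snd ℝ ℝ (ℝ × ℝ))).hasFDerivAt
      (HasFDerivAt.comp_hasDerivAt (l := prolong ψ) m.2.2 hφ.differentiableAt.hasFDerivAt hline)
  have hfrac : HasDerivAt (fun t : ℝ => (prolong ψ (m.1, m.2.1, t)).2.2)
      ((w.2 * (u.1 + m.2.2 * w.1) - (u.2 + m.2.2 * w.2) * w.1) / (u.1 + m.2.2 * w.1) ^ 2)
      m.2.2 := by
    have hd : ∀ a b : ℝ, HasDerivAt (fun t : ℝ => a + t * b) b m.2.2 := fun a b => by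
      simpa using ((hasDerivAt_id m.2.2).mul_const b).const_add a
    refine ((hd u.2 w.2).div (hd u.1 w.1) hp0).congr_of_eventuallyEq
      (Eventually.of_forall fun t => ?_)
    have := hlin t
    rw [planeProj_apply] at this
    simp [prolong, this]
  refine ⟨(w.2 * (u.1 + m.2.2 * w.1) - (u.2 + m.2.2 * w.2) * w.1) / (u.1 + m.2.2 * w.1) ^ 2,
    div_ne_zero (fun h => hJ (by linarith)) (pow_ne_zero 2 hp0), ?_⟩
  rw [planeProj_apply, Prod.ext_iff] at hproj
  have hz : planeProj (verticalField m) = 0 := rfl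
  rw [hz, map_zero] at hproj
  have h3 := hcurve.unique hfrac
  ext
  · simpa [verticalField] using hproj.1
  · simpa [verticalField] using hproj.2
  · simpa [verticalField] using h3

/-- A map that preserves the vertical direction covers a map of the plane. -/
theorem eventually_planeProj_eq {φ : ℝ × ℝ × ℝ → ℝ × ℝ × ℝ} {m₀ : ℝ × ℝ × ℝ}
    (hφ : SmoothNear φ m₀) (hV : MapsDirection φ verticalField verticalField m₀) :
    ∀ᶠ m in 𝓝 m₀, planeProj (φ m) = planeProj (φ (m.1, m.2.1, m₀.2.2)) := by
  obtain ⟨ε, hε, hball⟩ := Metric.eventually_nhds_iff_ball.1 (hφ.and hV)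
  filter_upwards [Metric.ball_mem_nhds m₀ hε] with m hm
  have hmem : ∀ t ∈ Metric.ball m₀.2.2 ε, (m.1, m.2.1, t) ∈ Metric.ball m₀ ε := by
    intro t ht
    simp only [Metric.mem_ball, Prod.dist_eq, max_lt_iff] at hm ht ⊢
    exact ⟨hm.1, hm.2.1, ht⟩
  have hd : ∀ t ∈ Metric.ball m₀.2.2 ε,
      HasDerivAt (fun t : ℝ => planeProj (φ (m.1, m.2.1, t))) 0 t := by
    intro t ht
    obtain ⟨hs, k, -, hk⟩ := hball _ (hmem t ht)
    have hline : HasDerivAt (fun t : ℝ => (m.1, m.2.1, t)) (verticalField m) t :=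
      (hasDerivAt_const _ _).prodMk ((hasDerivAt_const _ _).prodMk (hasDerivAt_id _))
    have h := planeProj.hasFDerivAt.comp_hasDerivAt t
      ((hs.differentiableAt (by simp)).hasFDerivAt.comp_hasDerivAt t hline)
    have h0 : planeProj (fderiv ℝ φ (m.1, m.2.1, t) (verticalField m)) = 0 := by
      change planeProj (fderiv ℝ φ (m.1, m.2.1, t) (verticalField (m.1, m.2.1, t))) = 0
      rw [hk, map_smul]
      exact smul_zero k
    rwa [h0] at h
  refine Metric.isOpen_ball.is_const_of_deriv_eq_zero
    (f := fun t : ℝ => planeProj (φ (m.1, m.2.1, t))) (convex_ball _ _).isPreconnected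
    (fun t ht => (hd t ht).differentiableAt.differentiableWithinAt)
    (fun t ht => (hd t ht).deriv) (x := m.2.2) ?_ (Metric.mem_ball_self hε)
  simp only [Metric.mem_ball, Prod.dist_eq, max_lt_iff] at hm ⊢
  exact hm.2.2

/-- The field `∂ₓ + p ∂_y + F ∂_p` of an explicit ODE. -/
def ExplicitODE.field (G : ExplicitODE) : ℝ × ℝ × ℝ → ℝ × ℝ × ℝ := jetField G.F

/-- Point transformations are the diffeomorphisms that preserve the vertical direction and the
contact planes; the latter condition follows from the vertical field and the field of the ODE being
respected. -/
theorem pointEquivalent_iff (G G' : ExplicitODE) :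
    PointEquivalent G G' ↔ PairEquiv verticalField G.field G.pt verticalField G'.field G'.pt := by
  constructor
  · rintro ⟨ψ, hψ, h0, hpt, htr⟩
    change IsLocalDiffeoNear ψ (planeProj G.pt) at hψ
    have hφ : SmoothNear (prolong ψ) G.pt := smoothNear_prolong hψ.1 h0
    have hV : ∀ᶠ m in 𝓝 G.pt, ∃ k : ℝ, k ≠ 0 ∧
        fderiv ℝ (prolong ψ) m (verticalField m) = k • verticalField (prolong ψ m) := by
      have hD : ContinuousAt
          (fun z : ℝ × ℝ × ℝ => (fderiv ℝ ψ (planeProj z) (1, z.2.2)).1) G.pt := by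
        have h1 : ContDiffAt ℝ ∞ (fun z => fderiv ℝ ψ (planeProj z)) G.pt :=
          (hψ.1.contDiffAt.fderiv_right (m := ∞) le_rfl).comp G.pt planeProj.contDiff.contDiffAt
        exact (h1.clm_apply (contDiffAt_const.prodMk contDiffAt_snd.snd)).fst.continuousAt
      filter_upwards [(tendsto_planeProj G.pt).eventually hψ.eventually, hD.eventually_ne h0]
        with m hm hm0 using exists_fderiv_prolong_vertical hm hm0
    have hproj : ∀ᶠ m in 𝓝 G.pt, ∀ v,
        planeProj (fderiv ℝ (prolong ψ) m v) = fderiv ℝ ψ (planeProj m) (planeProj v) := by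
      filter_upwards [hφ, (tendsto_planeProj G.pt).eventually hψ.1] with m h1 h2 v
      exact planeProj_fderiv (Eventually.of_forall fun z => rfl) (h1.differentiableAt (by simp))
        (h2.differentiableAt (by simp)) v
    refine ⟨prolong ψ, ⟨hφ, ?_⟩, hpt, hV, ?_⟩
    · have hinj : Function.Injective (fderiv ℝ (prolong ψ) G.pt) := by
        rw [injective_iff_map_eq_zero]
        intro v hv
        have h1 := hproj.self_of_nhds v
        rw [hv, map_zero] at h1
        have h2 := (injective_iff_map_eq_zero _).1 hψ.2.1 _ h1.symm
        rw [planeProj_apply, Prod.mk_eq_zero] at h2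
        obtain ⟨k, hk, hk'⟩ := hV.self_of_nhds
        have hvv : v = v.2.2 • verticalField G.pt := by
          ext <;> simp [verticalField, h2]
        rw [hvv, map_smul, hk', smul_smul] at hv
        have h3 : v.2.2 = 0 := by simpa [verticalField, hk] using hv
        rw [hvv, h3, zero_smul]
      exact ⟨hinj, LinearMap.injective_iff_surjective
        (f := (fderiv ℝ (prolong ψ) G.pt : ℝ × ℝ × ℝ →ₗ[ℝ] ℝ × ℝ × ℝ)).1 hinj⟩
    · filter_upwards [htr, hproj] with m hm hp
      obtain ⟨h1, h2⟩ := (hm (G.F m)).1 rfl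
      have h3 := hp (jetDirection m (G.F m))
      change _ = fderiv ℝ ψ (m.1, m.2.1) (1, m.2.2) at h3
      refine ⟨_, h1, ?_⟩
      rw [planeProj_apply] at h3
      simp only [ExplicitODE.Holds] at h2
      simp only [ExplicitODE.field, jetField] at *
      set w := fderiv ℝ (prolong ψ) m (jetDirection m (G.F m))
      have h4 : (prolong ψ m).2.2 = w.2.1 / w.1 := by
        simp [prolong, ← h3]
      rw [← h2]
      ext
      · simp [jetDirection]
      · simp [jetDirection, h4]; field_simp
      · simp [jetDirection]; field_simp
  · rintro ⟨φ, hφ, hpt, hV, hW⟩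
    let ι : ℝ × ℝ → ℝ × ℝ × ℝ := fun z => (z.1, z.2, G.pt.2.2)
    have hι : ContDiff ℝ ∞ ι := contDiff_fst.prodMk (contDiff_snd.prodMk contDiff_const)
    let ψ : ℝ × ℝ → ℝ × ℝ := fun z => planeProj (φ (ι z))
    have hψ : SmoothNear ψ (planeProj G.pt) :=
      SmoothNear.comp (g := planeProj) (f := fun z => φ (ι z)) (planeProj.contDiff.smoothNear _)
        (SmoothNear.comp (g := φ) (f := ι) (x := planeProj G.pt) hφ.1 (hι.smoothNear _))
    have hcov : ∀ᶠ m in 𝓝 G.pt, planeProj (φ m) = ψ (planeProj m) :=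
      eventually_planeProj_eq hφ.1 hV
    have hproj : ∀ᶠ m in 𝓝 G.pt, ∀ v,
        planeProj (fderiv ℝ φ m v) = fderiv ℝ ψ (planeProj m) (planeProj v) := by
      filter_upwards [hφ.1, (tendsto_planeProj G.pt).eventually hψ,
        eventually_eventually_nhds.2 hcov]
        with m h1 h2 h3 v
      exact planeProj_fderiv h3 (h1.differentiableAt (by simp)) (h2.differentiableAt (by simp)) v
    have hD : ∀ᶠ m in 𝓝 G.pt, ∃ l : ℝ, l ≠ 0 ∧
        fderiv ℝ φ m (jetDirection m (G.F m)) = l • jetDirection (φ m) (G'.F (φ m)) ∧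
        fderiv ℝ ψ (m.1, m.2.1) (1, m.2.2) = (l, l * (φ m).2.2) := by
      filter_upwards [hW, hproj] with m ⟨l, hl0, hl⟩ hp
      refine ⟨l, hl0, hl, ?_⟩
      have h := hp (jetDirection m (G.F m))
      rw [ExplicitODE.field, jetField] at hl
      rw [hl] at h
      refine h.symm.trans ?_
      simp [planeProj_apply, ExplicitODE.field, jetField, jetDirection]
    have heq : prolong ψ =ᶠ[𝓝 G.pt] φ := by
      filter_upwards [hD, hcov] with m ⟨l, hl0, _, hl⟩ hc
      rw [planeProj_apply, planeProj_apply] at hc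
      have h3 : (prolong ψ m).2.2 = (φ m).2.2 := by
        simp only [prolong, hl]; field_simp
      exact Prod.ext (congrArg Prod.fst hc).symm
        (Prod.ext (congrArg Prod.snd hc).symm h3)
    refine ⟨ψ, ⟨hψ, ?_⟩, ?_, heq.self_of_nhds.trans hpt, ?_⟩
    · have hsurj : Function.Surjective (fderiv ℝ ψ (planeProj G.pt)) := by
        intro w
        obtain ⟨v, hv⟩ := hφ.2.2 (w.1, w.2, 0)
        exact ⟨planeProj v, by rw [← hproj.self_of_nhds, hv]; rfl⟩
      exact ⟨LinearMap.injective_iff_surjective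
        (f := (fderiv ℝ ψ (planeProj G.pt) : ℝ × ℝ →ₗ[ℝ] ℝ × ℝ)).2 hsurj, hsurj⟩
    · obtain ⟨l, hl0, -, hl⟩ := hD.self_of_nhds
      rw [hl]
      exact hl0
    · filter_upwards [hD, hV, heq.eventuallyEq_nhds] with m ⟨l, hl0, hl, _⟩ ⟨k, hk0, hk⟩ he q
      rw [he.fderiv_eq, he.self_of_nhds, jetDirection_eq_add m q (G.F m), map_add, map_smul, hl, hk]
      simp only [ExplicitODE.Holds, verticalField, jetDirection, Prod.smul_mk, Prod.mk_add_mk,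
        smul_eq_mul, mul_one, mul_zero, add_zero]
      constructor
      · rintro rfl
        exact ⟨hl0, by field_simp; simp⟩
      · rintro ⟨-, h⟩
        rw [div_eq_iff hl0, mul_comm, add_eq_left] at h
        exact sub_eq_zero.1 ((mul_eq_zero.1 h).resolve_right hk0)

/-! ### Canonical coordinates -/

theorem SmoothNear.pd₁ {h : ℝ × ℝ × ℝ → ℝ} {u : ℝ × ℝ × ℝ} (hh : SmoothNear h u) :
    SmoothNear (pd₁ h) u :=
  hh.fderiv_apply (contDiff_const.smoothNear u)

theorem SmoothNear.pd₂ {h : ℝ × ℝ × ℝ → ℝ} {u : ℝ × ℝ × ℝ} (hh : SmoothNear h u) :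
    SmoothNear (pd₂ h) u :=
  hh.fderiv_apply (contDiff_const.smoothNear u)

theorem two_le_smooth : (2 : WithTop ℕ∞) ≤ ∞ :=
  show ((2 : ℕ∞) : WithTop ℕ∞) ≤ _ from WithTop.coe_le_coe.2 le_top

theorem pd₁_pd₂_comm {h : ℝ × ℝ × ℝ → ℝ} {u : ℝ × ℝ × ℝ} (hh : SmoothNear h u) :
    pd₁ (pd₂ h) u = pd₂ (pd₁ h) u := by
  have hd : DifferentiableAt ℝ (fderiv ℝ h) u :=
    (hh.contDiffAt.fderiv_right (m := ∞) le_rfl).differentiableAt (by simp)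
  have hsymm : IsSymmSndFDerivAt ℝ h u := hh.contDiffAt.isSymmSndFDerivAt
    (by simpa using two_le_smooth)
  have hv : ∀ v w : ℝ × ℝ × ℝ,
      fderiv ℝ (fun y => fderiv ℝ h y v) u w = fderiv ℝ (fderiv ℝ h) u w v := fun v w => by
    rw [fderiv_clm_apply hd (differentiableAt_const v)]
    simp
  change fderiv ℝ (fun y => fderiv ℝ h y (0, 1, 0)) u (1, 0, 0) =
    fderiv ℝ (fun y => fderiv ℝ h y (1, 0, 0)) u (0, 1, 0)
  rw [hv, hv, hsymm]

theorem fderiv_apply_pair (h : ℝ × ℝ × ℝ → ℝ) (u : ℝ × ℝ × ℝ) (v w : ℝ) :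
    fderiv ℝ h u (v, w, 0) = v * pd₁ h u + w * pd₂ h u := by
  have : ((v, w, 0) : ℝ × ℝ × ℝ) = v • (1, 0, 0) + w • (0, 1, 0) := by simp
  rw [this, map_add, map_smul, map_smul]
  rfl

theorem IsIntegralOf.eventually {lam a : ℝ × ℝ × ℝ → ℝ} {m₀ : ℝ × ℝ × ℝ}
    (h : IsIntegralOf lam a m₀) : ∀ᶠ m in 𝓝 m₀, IsIntegralOf lam a m :=
  h.1.eventually.and (eventually_eventually_nhds.2 h.2)

theorem lieBracket_jetField {lam mu : ℝ × ℝ × ℝ → ℝ} {m : ℝ × ℝ × ℝ}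
    (hl : SmoothNear lam m) (hm : SmoothNear mu m) :
    ∃ s : ℝ, VectorField.lieBracket ℝ (jetField lam) (jetField mu) m = (0, lam m - mu m, s) := by
  have hd : ∀ {nu : ℝ × ℝ × ℝ → ℝ}, SmoothNear nu m → ∀ v : ℝ × ℝ × ℝ,
      fderiv ℝ (jetField nu) m v = (0, v.2.2, fderiv ℝ nu m v) := fun {nu} hnu v => by
    have h2 : HasFDerivAt (fun m : ℝ × ℝ × ℝ => m.2.2)
      ((ContinuousLinearMap.snd ℝ ℝ ℝ).comp (ContinuousLinearMap.snd ℝ ℝ (ℝ × ℝ))) m :=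
      ((ContinuousLinearMap.snd ℝ ℝ ℝ).comp (ContinuousLinearMap.snd ℝ ℝ (ℝ × ℝ))).hasFDerivAt
    have := (hasFDerivAt_const (1 : ℝ) m).prodMk (h2.prodMk hnu.differentiableAt.hasFDerivAt)
    change fderiv ℝ (fun m : ℝ × ℝ × ℝ => ((1 : ℝ), m.2.2, nu m)) m v = _
    rw [this.fderiv]
    rfl
  refine ⟨fderiv ℝ mu m (jetField lam m) - fderiv ℝ lam m (jetField mu m), ?_⟩
  rw [VectorField.lieBracket, hd hl, hd hm]
  simp only [jetField, jetDirection, Prod.mk_sub_mk, sub_self]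

/-- The data from which canonical coordinates are built: integrals `a`, `b` of `y'' = lam` and an
integral `f` of `y'' = mu`, together forming local coordinates, and a function `h` of them that is
again an integral of `y'' = mu`. In contrast to `IsAssociatedWith`, the independence is expressed by
the inverse function theorem, which makes it an open condition on `m₀`. -/
structure IsCanonicalData (lam mu a b f h : ℝ × ℝ × ℝ → ℝ) (m₀ : ℝ × ℝ × ℝ) : Prop where
  smooth_lam : SmoothNear lam m₀
  smooth_mu : SmoothNear mu m₀
  ne : lam m₀ ≠ mu m₀
  integral_a : IsIntegralOf lam a m₀
  integral_b : IsIntegralOf lam b m₀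
  integral_f : IsIntegralOf mu f m₀
  coord : IsLocalDiffeoNear (fun m => (a m, b m, f m)) m₀
  smooth_h : SmoothNear h (a m₀, b m₀, f m₀)
  integral_h : IsIntegralOf mu (fun m => h (a m, b m, f m)) m₀
  pd₂_ne : pd₂ h (a m₀, b m₀, f m₀) ≠ 0

namespace IsCanonicalData

variable {lam mu a b f h : ℝ × ℝ × ℝ → ℝ} {m₀ : ℝ × ℝ × ℝ}

theorem eventually (H : IsCanonicalData lam mu a b f h m₀) :
    ∀ᶠ m in 𝓝 m₀, IsCanonicalData lam mu a b f h m := by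
  have hT := H.coord.1.continuousAt
  filter_upwards [H.smooth_lam.eventually, H.smooth_mu.eventually,
    H.smooth_lam.continuousAt.ne_iff_eventually_ne H.smooth_mu.continuousAt |>.1 H.ne,
    H.integral_a.eventually, H.integral_b.eventually, H.integral_f.eventually, H.coord.eventually,
    hT.eventually H.smooth_h.eventually, H.integral_h.eventually,
    hT.eventually (H.smooth_h.pd₂.continuousAt.eventually_ne H.pd₂_ne)]
    with m h1 h2 h3 h4 h5 h6 h7 h8 h9 h10 using ⟨h1, h2, h3, h4, h5, h6, h7, h8, h9, h10⟩

theorem fderiv_coord (H : IsCanonicalData lam mu a b f h m₀) (v : ℝ × ℝ × ℝ) :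
    fderiv ℝ (fun m => (a m, b m, f m)) m₀ v =
      (fderiv ℝ a m₀ v, fderiv ℝ b m₀ v, fderiv ℝ f m₀ v) := by
  have := H.integral_a.1.differentiableAt.hasFDerivAt.prodMk
    (H.integral_b.1.differentiableAt.hasFDerivAt.prodMk H.integral_f.1.differentiableAt.hasFDerivAt)
  rw [this.fderiv]
  rfl

theorem fderiv_coord_ne_zero (H : IsCanonicalData lam mu a b f h m₀) (q : ℝ) :
    (fderiv ℝ a m₀ (jetDirection m₀ q), fderiv ℝ b m₀ (jetDirection m₀ q),
      fderiv ℝ f m₀ (jetDirection m₀ q)) ≠ 0 := by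
  rw [← H.fderiv_coord]
  intro h0
  have := (injective_iff_map_eq_zero _).1 H.coord.2.1 _ h0
  simp [jetDirection] at this

/-- The third canonical coordinate `c = - h_a / h_b` as a function on the space of `(x, y, p)`. -/
def third (a b f h : ℝ × ℝ × ℝ → ℝ) (m : ℝ × ℝ × ℝ) : ℝ :=
  (canonicalCoord h (a m, b m, f m)).2.2

theorem smooth_third (H : IsCanonicalData lam mu a b f h m₀) :
    SmoothNear (third a b f h) m₀ := by
  have h1 : SmoothNear (fun u => -(pd₁ h u / pd₂ h u)) (a m₀, b m₀, f m₀) := by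
    filter_upwards [H.smooth_h.pd₁.div H.smooth_h.pd₂ H.pd₂_ne] with u hu using hu.neg
  exact SmoothNear.comp (f := fun m => (a m, b m, f m)) h1 H.coord.1

theorem smooth_map (H : IsCanonicalData lam mu a b f h m₀) :
    SmoothNear (fun m => canonicalCoord h (a m, b m, f m)) m₀ :=
  H.integral_a.1.prodMk (H.integral_b.1.prodMk H.smooth_third)

theorem fderiv_map (H : IsCanonicalData lam mu a b f h m₀) (v : ℝ × ℝ × ℝ) :
    fderiv ℝ (fun m => canonicalCoord h (a m, b m, f m)) m₀ v =
      (fderiv ℝ a m₀ v, fderiv ℝ b m₀ v, fderiv ℝ (third a b f h) m₀ v) := by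
  have := H.integral_a.1.differentiableAt.hasFDerivAt.prodMk
    (H.integral_b.1.differentiableAt.hasFDerivAt.prodMk H.smooth_third.differentiableAt.hasFDerivAt)
  change fderiv ℝ (fun m => (a m, b m, third a b f h m)) m₀ v = _
  rw [this.fderiv]
  rfl

/-- Along the field of `mu` the coordinates satisfy `db = c da`. -/
theorem fderiv_b_mu (H : IsCanonicalData lam mu a b f h m₀) :
    fderiv ℝ b m₀ (jetField mu m₀) = third a b f h m₀ * fderiv ℝ a m₀ (jetField mu m₀) := by
  have hg := H.integral_h.2.self_of_nhds
  have hf := H.integral_f.2.self_of_nhds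
  rw [fderiv_fun_comp m₀ H.smooth_h.differentiableAt H.coord.1.differentiableAt,
    ContinuousLinearMap.comp_apply, H.fderiv_coord, hf, fderiv_apply_pair] at hg
  have := H.pd₂_ne
  simp only [third, canonicalCoord, jetField]
  field_simp
  linarith

theorem fderiv_a_mu_ne_zero (H : IsCanonicalData lam mu a b f h m₀) :
    fderiv ℝ a m₀ (jetField mu m₀) ≠ 0 := by
  intro h0
  apply H.fderiv_coord_ne_zero (mu m₀)
  have hb := H.fderiv_b_mu
  rw [h0, mul_zero] at hb
  have hf := H.integral_f.2.self_of_nhds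
  rw [jetField] at h0 hb
  rw [h0, hb, hf]
  rfl

/-- The derivative of `c h_b = - h_a`. -/
theorem fderiv_third (H : IsCanonicalData lam mu a b f h m₀) (v : ℝ × ℝ × ℝ) :
    fderiv ℝ (third a b f h) m₀ v * pd₂ h (a m₀, b m₀, f m₀) =
      -(fderiv ℝ (pd₁ h) (a m₀, b m₀, f m₀) (fderiv ℝ a m₀ v, fderiv ℝ b m₀ v, fderiv ℝ f m₀ v) +
        third a b f h m₀ * fderiv ℝ (pd₂ h) (a m₀, b m₀, f m₀)
          (fderiv ℝ a m₀ v, fderiv ℝ b m₀ v, fderiv ℝ f m₀ v)) := by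
  have hT : HasFDerivAt (fun m => (a m, b m, f m))
      (fderiv ℝ (fun m => (a m, b m, f m)) m₀) m₀ := H.coord.1.differentiableAt.hasFDerivAt
  have h1 := HasFDerivAt.comp (g := pd₁ h) m₀ H.smooth_h.pd₁.differentiableAt.hasFDerivAt hT
  have h2 := HasFDerivAt.comp (g := pd₂ h) m₀ H.smooth_h.pd₂.differentiableAt.hasFDerivAt hT
  have h3 := HasFDerivAt.mul H.smooth_third.differentiableAt.hasFDerivAt h2
  have heq : (fun m => -(pd₁ h (a m, b m, f m))) =ᶠ[𝓝 m₀]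
      fun m => third a b f h m * pd₂ h (a m, b m, f m) := by
    filter_upwards [H.eventually] with m hm
    simp [third, canonicalCoord, hm.pd₂_ne]
  have h4 := DFunLike.congr_fun ((h3.congr_of_eventuallyEq heq).unique h1.neg) v
  simp only [add_apply, smul_apply,
    ContinuousLinearMap.comp_apply, neg_apply, smul_eq_mul,
    Function.comp_apply, H.fderiv_coord] at h4
  linarith

/-- The field of `mu` is, in canonical coordinates, proportional to the field of the associated
ODE. -/
theorem fderiv_third_mu (H : IsCanonicalData lam mu a b f h m₀) :
    fderiv ℝ (third a b f h) m₀ (jetField mu m₀) = fderiv ℝ a m₀ (jetField mu m₀) *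
      -(flex h (a m₀, b m₀, f m₀) / pd₂ h (a m₀, b m₀, f m₀) ^ 3) := by
  have hf : fderiv ℝ f m₀ (jetField mu m₀) = 0 := H.integral_f.2.self_of_nhds
  have hv := H.fderiv_third (jetField mu m₀)
  rw [hf, fderiv_apply_pair, fderiv_apply_pair, H.fderiv_b_mu, pd₁_pd₂_comm H.smooth_h] at hv
  have h0 := H.pd₂_ne
  apply mul_right_cancel₀ h0
  rw [hv]
  simp only [third, canonicalCoord, flex]
  field_simp
  ring

/-- The contact planes are not integrable: `c` is not constant along the fibres. Otherwise the
form `db - c da` would vanish on both fields and on their bracket, hence everywhere. -/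
theorem fderiv_third_lam_ne_zero (H : IsCanonicalData lam mu a b f h m₀) :
    fderiv ℝ (third a b f h) m₀ (jetField lam m₀) ≠ 0 := by
  intro h0
  obtain ⟨s, hs⟩ := lieBracket_jetField H.smooth_lam H.smooth_mu
  have hbr : ∀ {φ : ℝ × ℝ × ℝ → ℝ}, IsIntegralOf lam φ m₀ →
      fderiv ℝ φ m₀ (0, lam m₀ - mu m₀, s) =
        fderiv ℝ (fun m => fderiv ℝ φ m (jetField mu m)) m₀ (jetField lam m₀) := by
    intro φ hφ
    have hz : (fun m => fderiv ℝ φ m (jetField lam m)) =ᶠ[𝓝 m₀] fun _ => 0 := hφ.2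
    rw [← hs, VectorField.fderiv_apply_lieBracket (n := ∞) hφ.1.contDiffAt
      (by simpa using two_le_smooth)
      H.smooth_mu.jetField.differentiableAt H.smooth_lam.jetField.differentiableAt,
      hz.fderiv_eq]
    simp
  have hev : (fun m => fderiv ℝ b m (jetField mu m)) =ᶠ[𝓝 m₀]
      fun m => third a b f h m * fderiv ℝ a m (jetField mu m) := by
    filter_upwards [H.eventually] with m hm using hm.fderiv_b_mu
  set c := third a b f h m₀ with hc
  have hB : fderiv ℝ b m₀ (0, lam m₀ - mu m₀, s) = c * fderiv ℝ a m₀ (0, lam m₀ - mu m₀, s) := by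
    rw [hbr H.integral_b, hbr H.integral_a, hev.fderiv_eq,
      fderiv_fun_mul H.smooth_third.differentiableAt
        (H.integral_a.1.fderiv_apply H.smooth_mu.jetField).differentiableAt]
    simp [h0, hc]
  let θ : ℝ × ℝ × ℝ →L[ℝ] ℝ := fderiv ℝ b m₀ - c • fderiv ℝ a m₀
  have hθl : θ (jetField lam m₀) = 0 := by
    have h1 : fderiv ℝ a m₀ (jetField lam m₀) = 0 := H.integral_a.2.self_of_nhds
    have h2 : fderiv ℝ b m₀ (jetField lam m₀) = 0 := H.integral_b.2.self_of_nhds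
    simp [θ, h1, h2]
  have hθm : θ (jetField mu m₀) = 0 := by
    have := H.fderiv_b_mu
    simp [θ, this, hc]
  have hθB : θ (0, lam m₀ - mu m₀, s) = 0 := by simp [θ, hB]
  have hne := sub_ne_zero.2 H.ne
  have hθ : ∀ v, θ v = 0 := fun v => by
    set d := lam m₀ - mu m₀ with hd
    have hv : v = v.1 • jetField lam m₀ + ((v.2.1 - m₀.2.2 * v.1) / d) • (0, d, s) +
        ((v.2.2 - lam m₀ * v.1 - (v.2.1 - m₀.2.2 * v.1) / d * s) / d) •
          (jetField lam m₀ - jetField mu m₀) := by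
      ext
      · simp [jetField, jetDirection]
      · simp [jetField, jetDirection]; field_simp; ring
      · simp [jetField, jetDirection, ← hd]; field_simp; ring
    rw [hv, map_add, map_add, map_smul, map_smul, map_smul, map_sub, hθl, hθm, hθB]
    simp
  obtain ⟨v, hv⟩ := H.coord.2.2 (0, 1, 0)
  rw [H.fderiv_coord] at hv
  have := hθ v
  simp only [Prod.mk.injEq] at hv
  simp [θ, hv.1, hv.2.1] at this

/-- The kernel of `(da, db)` is the direction of `lam`, on which `dc` does not vanish. -/
theorem injective_fderiv_map (H : IsCanonicalData lam mu a b f h m₀) :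
    Function.Injective (fderiv ℝ (fun m => canonicalCoord h (a m, b m, f m)) m₀) := by
  have ha : fderiv ℝ a m₀ (jetField lam m₀) = 0 := H.integral_a.2.self_of_nhds
  have hb : fderiv ℝ b m₀ (jetField lam m₀) = 0 := H.integral_b.2.self_of_nhds
  have hf : fderiv ℝ f m₀ (jetField lam m₀) ≠ 0 := by
    intro hf
    apply H.fderiv_coord_ne_zero (lam m₀)
    rw [jetField] at ha hb hf
    rw [ha, hb, hf]
    rfl
  rw [injective_iff_map_eq_zero]
  intro v hv
  rw [H.fderiv_map, Prod.mk_eq_zero, Prod.mk_eq_zero] at hv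
  have hinj := (injective_iff_map_eq_zero _).1 H.coord.2.1
  -- `v` is killed by `da` and `db`, so it is a multiple of the field of `lam`
  have hpar : fderiv ℝ f m₀ (jetField lam m₀) • v - fderiv ℝ f m₀ v • jetField lam m₀ = 0 := by
    apply hinj
    rw [H.fderiv_coord]
    simp [ha, hb, hv.1, hv.2.1, mul_comm]
  have h3 := congrArg (fderiv ℝ (third a b f h) m₀) hpar
  rw [map_sub, map_smul, map_smul, hv.2.2, map_zero, smul_zero, zero_sub, neg_eq_zero, smul_eq_mul,
    mul_eq_zero, or_iff_left H.fderiv_third_lam_ne_zero] at h3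
  apply hinj
  rw [H.fderiv_coord, hv.1, hv.2.1, h3]
  rfl

theorem isLocalDiffeoNear_map (H : IsCanonicalData lam mu a b f h m₀) :
    IsLocalDiffeoNear (fun m => canonicalCoord h (a m, b m, f m)) m₀ :=
  ⟨H.smooth_map, H.injective_fderiv_map, LinearMap.injective_iff_surjective
    (f := (fderiv ℝ (fun m => canonicalCoord h (a m, b m, f m)) m₀ :
      ℝ × ℝ × ℝ →ₗ[ℝ] ℝ × ℝ × ℝ)).1 H.injective_fderiv_map⟩

theorem mapsDirection_lam (H : IsCanonicalData lam mu a b f h m₀) :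
    MapsDirection (fun m => canonicalCoord h (a m, b m, f m)) (jetField lam) verticalField m₀ := by
  filter_upwards [H.eventually] with m hm
  refine ⟨_, hm.fderiv_third_lam_ne_zero, ?_⟩
  have ha : fderiv ℝ a m (jetField lam m) = 0 := hm.integral_a.2.self_of_nhds
  have hb : fderiv ℝ b m (jetField lam m) = 0 := hm.integral_b.2.self_of_nhds
  rw [hm.fderiv_map, ha, hb]
  simp [verticalField]

theorem mapsDirection_mu (H : IsCanonicalData lam mu a b f h m₀) {F : ℝ × ℝ × ℝ → ℝ}
    (hF : ∀ᶠ u in 𝓝 (a m₀, b m₀, f m₀), F (canonicalCoord h u) = -(flex h u / pd₂ h u ^ 3)) :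
    MapsDirection (fun m => canonicalCoord h (a m, b m, f m)) (jetField mu) (jetField F) m₀ := by
  filter_upwards [H.eventually, H.coord.1.continuousAt.eventually hF] with m hm hFm
  refine ⟨_, hm.fderiv_a_mu_ne_zero, ?_⟩
  rw [hm.fderiv_map, hm.fderiv_third_mu, hm.fderiv_b_mu, ← hFm]
  ext
  · simp [jetField, jetDirection]
  · simp [jetField, jetDirection, third, mul_comm]
  · simp [jetField, jetDirection]

end IsCanonicalData

/-! ### Composition operators on spaces of continuous paths -/

section SuperpositionOperator

universe u

variable {K : Type*} [TopologicalSpace K] [CompactSpace K]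
variable {E : Type u} [NormedAddCommGroup E] [NormedSpace ℝ E]

/-- Pointwise application of a continuous family of linear maps to a continuous function, as a
continuous bilinear map. -/
def applyFamily (K : Type*) [TopologicalSpace K] [CompactSpace K] (E F : Type*)
    [NormedAddCommGroup E] [NormedSpace ℝ E] [NormedAddCommGroup F] [NormedSpace ℝ F] :
    C(K, E →L[ℝ] F) →L[ℝ] C(K, E) →L[ℝ] C(K, F) :=
  LinearMap.mkContinuous₂
    (LinearMap.mk₂ ℝ (fun (A : C(K, E →L[ℝ] F)) (γ : C(K, E)) =>
      (⟨fun t => A t (γ t), by fun_prop⟩ : C(K, F)))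
      (fun A B γ => by ext; simp) (fun c A γ => by ext; simp)
      (fun A γ η => by ext; simp) (fun c A γ => by ext; simp)) 1 (fun A γ => by
    rw [one_mul, ContinuousMap.norm_le _ (by positivity)]
    intro t
    exact (A t).le_of_opNorm_le_of_le (A.norm_coe_le_norm t) (γ.norm_coe_le_norm t))

/-- Composition with a `C¹` function of compact support is a differentiable operator on continuous
functions: the derivative being uniformly continuous, the first order expansion is uniform. -/
theorem hasFDerivAt_comp_left {F : Type*} [NormedAddCommGroup F] [NormedSpace ℝ F] (X : C(E, F))
    (hX : Differentiable ℝ X) (DX : C(E, E →L[ℝ] F)) (hDX : ∀ x, DX x = fderiv ℝ X x)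
    (hu : UniformContinuous DX) (γ : C(K, E)) :
    HasFDerivAt (fun γ : C(K, E) => X.comp γ) (applyFamily K E F (DX.comp γ)) γ := by
  rw [hasFDerivAt_iff_isLittleO, Asymptotics.isLittleO_iff]
  intro c hc
  obtain ⟨δ, hδ, hδc⟩ := Metric.uniformContinuous_iff.1 hu c hc
  filter_upwards [Metric.ball_mem_nhds γ hδ] with η hη
  rw [ContinuousMap.norm_le _ (by positivity)]
  intro t
  have hηt : η t ∈ Metric.ball (γ t) δ := (ContinuousMap.dist_apply_le_dist t).trans_lt hη
  have h := (convex_ball (γ t) δ).norm_image_sub_le_of_norm_fderiv_le' (𝕜 := ℝ) (f := X)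
    (φ := DX (γ t)) (C := c) (fun x _ => hX x)
    (fun x hx => by rw [← hDX, ← dist_eq_norm]; exact (hδc hx).le) (Metric.mem_ball_self hδ) hηt
  refine h.trans (mul_le_mul_of_nonneg_left ?_ hc.le)
  exact (η - γ).norm_coe_le_norm t

theorem contDiff_nat_comp_left (n : ℕ) :
    ∀ {F : Type u} [NormedAddCommGroup F] [NormedSpace ℝ F] (X : C(E, F)), ContDiff ℝ ∞ X →
      HasCompactSupport X → ContDiff ℝ n (fun γ : C(K, E) => X.comp γ) := by
  induction n with
  | zero =>
    intro F _ _ X _ _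
    exact contDiff_zero.2 X.continuous_postcomp
  | succ n ih =>
    intro F _ _ X hX hc
    have hX' : ContDiff ℝ ∞ (fderiv ℝ X) := hX.fderiv_right (m := ∞) le_rfl
    let DX : C(E, E →L[ℝ] F) := ⟨fderiv ℝ X, hX'.continuous⟩
    have hc' : HasCompactSupport DX := hc.fderiv (𝕜 := ℝ)
    have hM : ContDiff ℝ n (applyFamily K E F) :=
      ContinuousLinearMap.contDiff (𝕜 := ℝ) (E := C(K, E →L[ℝ] F)) (F := C(K, E) →L[ℝ] C(K, F))
        (applyFamily K E F)
    rw [Nat.cast_add, Nat.cast_one, contDiff_succ_iff_hasFDerivAt]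
    exact ⟨fun γ => applyFamily K E F (DX.comp γ),
      hM.comp (ih DX hX' hc'),
      hasFDerivAt_comp_left X (hX.differentiable (by simp)) DX (fun _ => rfl)
        (hc'.uniformContinuous_of_continuous DX.continuous)⟩

/-- Composition with a smooth function of compact support is a smooth operator on continuous
functions. -/
theorem contDiff_comp_left {F : Type u} [NormedAddCommGroup F] [NormedSpace ℝ F] (X : C(E, F))
    (hX : ContDiff ℝ ∞ X) (hc : HasCompactSupport X) :
    ContDiff ℝ ∞ (fun γ : C(K, E) => X.comp γ) :=
  contDiff_infty.2 fun n => contDiff_nat_comp_left n X hX hc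

end SuperpositionOperator

section Primitive

theorem continuous_extend {E : Type*} [NormedAddCommGroup E] (γ : C(Set.Icc (0 : ℝ) 1, E)) :
    Continuous (Set.IccExtend (zero_le_one (α := ℝ)) γ) := γ.continuous.Icc_extend'

/-- The operator sending a path `γ` on the unit interval to `t ↦ ∫₀ᵗ γ`. -/
def primitive (E : Type*) [NormedAddCommGroup E] [NormedSpace ℝ E] :
    C(Set.Icc (0 : ℝ) 1, E) →L[ℝ] C(Set.Icc (0 : ℝ) 1, E) :=
  LinearMap.mkContinuous
    { toFun := fun γ => ⟨fun t => ∫ s in (0 : ℝ)..t, Set.IccExtend zero_le_one γ s,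
        (intervalIntegral.continuous_primitive
          (fun a b => (continuous_extend γ).intervalIntegrable a b) 0).comp continuous_subtype_val⟩
      map_add' := fun γ η => by
        ext t
        exact intervalIntegral.integral_add ((continuous_extend γ).intervalIntegrable _ _)
          ((continuous_extend η).intervalIntegrable _ _)
      map_smul' := fun c γ => by
        ext t
        exact intervalIntegral.integral_smul c _ } 1 (fun γ => by
    rw [one_mul, ContinuousMap.norm_le _ (norm_nonneg _)]
    intro t
    have h := intervalIntegral.norm_integral_le_of_norm_le_const (a := (0 : ℝ)) (b := t)
      (f := Set.IccExtend zero_le_one γ) (C := ‖γ‖) (fun s _ => γ.norm_coe_le_norm _)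
    refine h.trans ?_
    rw [sub_zero, abs_of_nonneg t.2.1]
    exact mul_le_of_le_one_right (norm_nonneg _) t.2.2)

end Primitive

/-- A map that is smooth near a point coincides near it with a smooth map of compact support. -/
theorem SmoothNear.exists_cutoff {E F : Type*} [NormedAddCommGroup E] [NormedSpace ℝ E]
    [FiniteDimensional ℝ E] [NormedAddCommGroup F] [NormedSpace ℝ F] {f : E → F} {x : E}
    (hf : SmoothNear f x) :
    ∃ X : E → F, ContDiff ℝ ∞ X ∧ HasCompactSupport X ∧ X =ᶠ[𝓝 x] f := by
  obtain ⟨ε, hε, hball⟩ := Metric.eventually_nhds_iff_ball.1 hf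
  let χ : ContDiffBump x := ⟨ε / 4, ε / 2, by positivity, by linarith⟩
  refine ⟨fun y => χ y • f y, ?_, χ.hasCompactSupport.smul_right, ?_⟩
  · rw [contDiff_iff_contDiffAt]
    intro y
    by_cases hy : y ∈ tsupport χ
    · refine χ.contDiffAt.smul (hball y ?_)
      rw [χ.tsupport_eq] at hy
      exact Metric.closedBall_subset_ball (by linarith : ε / 2 < ε) hy
    · refine (contDiffAt_const (c := (0 : F))).congr_of_eventuallyEq ?_
      filter_upwards [notMem_tsupport_iff_eventuallyEq.1 hy] with z hz
      simp [hz]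
  · filter_upwards [χ.eventuallyEq_one] with y hy
    simp [hy]

/-! ### The flow of a field and its integrals -/

section Paths

variable {E : Type*} [NormedAddCommGroup E] [NormedSpace ℝ E]

/-- The integral equation `γ(t) = m + ε ∫₀ᵗ X(γ(s)) ds`, `0 ≤ t ≤ 1`, of the flow of `X` for the
time `ε`. The parameters `m`, `ε` are kept as components, so that solving the equation means
inverting this map on `(m, ε, 0)`. -/
def flowEquation (X : C(E, E)) (z : E × ℝ × C(Set.Icc (0 : ℝ) 1, E)) :
    E × ℝ × C(Set.Icc (0 : ℝ) 1, E) :=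
  (z.1, z.2.1, z.2.2 - ContinuousMap.const _ z.1 - z.2.1 • primitive E (X.comp z.2.2))

theorem flowEquation_eq_iff {X : C(E, E)} {m : E} {ε : ℝ} {γ : C(Set.Icc (0 : ℝ) 1, E)} :
    flowEquation X (m, ε, γ) = (m, ε, 0) ↔
      ∀ t, γ t = m + ε • ∫ s in (0 : ℝ)..t, Set.IccExtend zero_le_one (X.comp γ) s := by
  simp only [flowEquation, Prod.mk.injEq, true_and]
  rw [sub_sub, sub_eq_zero, ContinuousMap.ext_iff]
  rfl

/-- For `ε = 0` the equation reads `γ = m`, and its derivative in `γ` is the identity. -/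
theorem isLocalDiffeoNear_flowEquation {E : Type} [NormedAddCommGroup E] [NormedSpace ℝ E]
    {X : C(E, E)} (hX : ContDiff ℝ ∞ X) (hc : HasCompactSupport X) (m₀ : E) :
    IsLocalDiffeoNear (flowEquation X) (m₀, 0, ContinuousMap.const _ m₀) := by
  set γ₀ : C(Set.Icc (0 : ℝ) 1, E) := ContinuousMap.const _ m₀
  let P := E × ℝ × C(Set.Icc (0 : ℝ) 1, E)
  have hconst : ContDiff ℝ ∞ (fun z : P => ContinuousMap.const (Set.Icc (0 : ℝ) 1) z.1) :=
    ContDiff.comp (g := ContinuousLinearMap.const (R := ℝ) (M := E) (Set.Icc (0 : ℝ) 1))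
      (ContinuousLinearMap.contDiff (𝕜 := ℝ) (E := E) (F := C(Set.Icc (0 : ℝ) 1, E)) _) contDiff_fst
  have hprim : ContDiff ℝ ∞ (fun z : P => primitive E (X.comp z.2.2)) :=
    ContDiff.comp (g := primitive E)
      (ContinuousLinearMap.contDiff (𝕜 := ℝ) (E := C(Set.Icc (0 : ℝ) 1, E))
        (F := C(Set.Icc (0 : ℝ) 1, E)) _)
      (ContDiff.comp (contDiff_comp_left X hX hc) contDiff_snd.snd)
  have hsm : ContDiff ℝ ∞ (flowEquation X) :=
    contDiff_fst.prodMk (contDiff_snd.fst.prodMk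
      ((contDiff_snd.snd.sub hconst).sub (contDiff_snd.fst.smul hprim)))
  refine ⟨hsm.smoothNear _, ?_⟩
  have hfd : ∀ v : P, fderiv ℝ (flowEquation X) (m₀, 0, γ₀) v = (v.1, v.2.1,
      v.2.2 - ContinuousMap.const _ v.1 - v.2.1 • primitive E (X.comp γ₀)) := by
    intro v
    have h1 : HasFDerivAt (fun z : P => z.1) (ContinuousLinearMap.fst ℝ _ _) (m₀, 0, γ₀) :=
      hasFDerivAt_fst
    have h2 : HasFDerivAt (fun z : P => z.2.1) ((ContinuousLinearMap.fst ℝ _ _).comp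
      (ContinuousLinearMap.snd ℝ _ _)) (m₀, 0, γ₀) := hasFDerivAt_snd.fst
    have h3 : HasFDerivAt (fun z : P => z.2.2) ((ContinuousLinearMap.snd ℝ _ _).comp
      (ContinuousLinearMap.snd ℝ _ _)) (m₀, 0, γ₀) := hasFDerivAt_snd.snd
    have h4 : HasFDerivAt (fun z : P => ContinuousMap.const (Set.Icc (0 : ℝ) 1) z.1)
        ((ContinuousLinearMap.const (R := ℝ) (M := E) (Set.Icc (0 : ℝ) 1)).comp
          (ContinuousLinearMap.fst ℝ _ _)) (m₀, 0, γ₀) :=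
      HasFDerivAt.comp (g := ContinuousLinearMap.const (R := ℝ) (M := E) (Set.Icc (0 : ℝ) 1))
        _ (ContinuousLinearMap.hasFDerivAt (𝕜 := ℝ) (E := E) (F := C(Set.Icc (0 : ℝ) 1, E)) _) h1
    have h5 := ((hprim.differentiable (by simp)) (m₀, 0, γ₀)).hasFDerivAt
    have h := h1.prodMk (h2.prodMk ((h3.sub h4).sub (h2.smul h5)))
    have h' : fderiv ℝ (flowEquation X) (m₀, 0, γ₀) = _ := HasFDerivAt.fderiv h
    rw [h']
    simp
    rfl
  constructor
  · rw [injective_iff_map_eq_zero]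
    intro v hv
    rw [hfd, Prod.mk_eq_zero, Prod.mk_eq_zero] at hv
    obtain ⟨h1, h2, h3⟩ := hv
    rw [h1, h2] at h3
    have h4 : v.2.2 = 0 := by
      ext t
      simpa using DFunLike.congr_fun h3 t
    exact Prod.ext h1 (Prod.ext h2 h4)
  · intro w
    refine ⟨(w.1, w.2.1,
      w.2.2 + ContinuousMap.const _ w.1 + w.2.1 • primitive E (X.comp γ₀)), ?_⟩
    rw [hfd]
    refine Prod.ext rfl (Prod.ext rfl ?_)
    dsimp only
    abel

/-- The tail of a path from the time `t` on, run through in unit time. -/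
def pathTail (γ : C(Set.Icc (0 : ℝ) 1, E)) (t : Set.Icc (0 : ℝ) 1) : C(Set.Icc (0 : ℝ) 1, E) where
  toFun s := Set.IccExtend zero_le_one γ (t + (1 - t) * s)
  continuous_toFun := (continuous_extend γ).comp (by fun_prop)

theorem add_mul_mem_Icc (t s : Set.Icc (0 : ℝ) 1) :
    (t : ℝ) + (1 - t) * s ∈ Set.Icc (0 : ℝ) 1 := by
  obtain ⟨t, ht0, ht1⟩ := t
  obtain ⟨s, hs0, hs1⟩ := s
  constructor
  · have := mul_nonneg (sub_nonneg.2 ht1) hs0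
    simp only
    linarith
  · have := mul_nonneg (sub_nonneg.2 ht1) (sub_nonneg.2 hs1)
    simp only
    linarith

/-- The flow property: the tail of a solution solves the equation for the remaining time. -/
theorem flowEquation_pathTail {X : C(E, E)} {m : E} {ε : ℝ}
    {γ : C(Set.Icc (0 : ℝ) 1, E)} (h : flowEquation X (m, ε, γ) = (m, ε, 0))
    (t : Set.Icc (0 : ℝ) 1) :
    flowEquation X (γ t, (1 - t) * ε, pathTail γ t) = (γ t, (1 - t) * ε, 0) := by
  rw [flowEquation_eq_iff] at h ⊢
  intro s
  have hint := fun a b => (continuous_extend (X.comp γ)).intervalIntegrable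
    (μ := MeasureTheory.volume) a b
  have hcongr : ∫ r in (0 : ℝ)..s, Set.IccExtend zero_le_one (X.comp (pathTail γ t)) r =
      ∫ r in (0 : ℝ)..s, Set.IccExtend zero_le_one (X.comp γ) (t + (1 - t) * r) := by
    refine intervalIntegral.integral_congr fun r hr => ?_
    rw [Set.uIcc_of_le s.2.1] at hr
    have hr' : r ∈ Set.Icc (0 : ℝ) 1 := ⟨hr.1, hr.2.trans s.2.2⟩
    rw [Set.IccExtend_of_mem _ _ hr', Set.IccExtend_of_mem _ _ (add_mul_mem_Icc t ⟨r, hr'⟩)]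
    simp only [ContinuousMap.comp_apply, pathTail, ContinuousMap.coe_mk]
    rw [Set.IccExtend_of_mem _ _ (add_mul_mem_Icc t ⟨r, hr'⟩)]
  have htail : pathTail γ t s = γ ⟨_, add_mul_mem_Icc t s⟩ :=
    Set.IccExtend_of_mem _ _ (add_mul_mem_Icc t s)
  rw [htail, h, h t, hcongr, mul_comm (1 - (t : ℝ)) ε, mul_smul,
    intervalIntegral.smul_integral_comp_add_mul,
    add_assoc, ← smul_add, mul_zero, add_zero,
    intervalIntegral.integral_add_adjacent_intervals (hint _ _) (hint _ _)]

end Paths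

/-- Near `m₀`, the point at which the integral curve of `y'' = lam` through `m` meets the plane
`x = x₀` depends smoothly on `m` and is constant along the integral curves. As the field has first
component `1`, this is the flow for the time `ε = x₀ - x`. -/
theorem exists_initialPoint {lam : ℝ × ℝ × ℝ → ℝ} {m₀ : ℝ × ℝ × ℝ} (hlam : SmoothNear lam m₀) :
    ∃ Q : ℝ × ℝ × ℝ → ℝ × ℝ × ℝ, SmoothNear Q m₀ ∧
      (∀ᶠ m in 𝓝 m₀, m.1 = m₀.1 → Q m = m) ∧
      ∀ᶠ m in 𝓝 m₀, fderiv ℝ Q m (jetField lam m) = 0 := by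
  obtain ⟨X', hX, hc, hXl⟩ := hlam.jetField.exists_cutoff
  let X : C(ℝ × ℝ × ℝ, ℝ × ℝ × ℝ) := ⟨X', hX.continuous⟩
  have hdiffeo := isLocalDiffeoNear_flowEquation (X := X) hX hc m₀
  obtain ⟨g, hg, hg0, hr, hl⟩ := hdiffeo.exists_inverse
  set γ₀ : C(Set.Icc (0 : ℝ) 1, ℝ × ℝ × ℝ) := ContinuousMap.const _ m₀
  have hpt : flowEquation X (m₀, 0, γ₀) = (m₀, 0, 0) :=
    flowEquation_eq_iff.2 fun t => by simp [γ₀]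
  rw [hpt] at hg hg0 hr
  -- the data for the flow from `m` to the plane `x = x₀`
  let ι : ℝ × ℝ × ℝ → (ℝ × ℝ × ℝ) × ℝ × C(Set.Icc (0 : ℝ) 1, ℝ × ℝ × ℝ) :=
    fun m => (m, m₀.1 - m.1, 0)
  have hι : ContDiff ℝ ∞ ι := contDiff_id.prodMk ((contDiff_const.sub contDiff_fst).prodMk
    contDiff_const)
  have hι0 : ι m₀ = (m₀, 0, 0) := by simp [ι]
  have hgι : SmoothNear (fun m => g (ι m)) m₀ :=
    SmoothNear.comp (g := g) (f := ι) (hι0.symm ▸ hg.1) (hι.smoothNear m₀)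
  have hιt : Tendsto ι (𝓝 m₀) (𝓝 (m₀, 0, 0)) := hι0 ▸ hι.continuous.continuousAt
  let ev : C(Set.Icc (0 : ℝ) 1, ℝ × ℝ × ℝ) →L[ℝ] ℝ × ℝ × ℝ := ContinuousMap.evalCLM ℝ 1
  let Q : ℝ × ℝ × ℝ → ℝ × ℝ × ℝ := fun m => ev (g (ι m)).2.2
  have hQ : SmoothNear Q m₀ :=
    SmoothNear.comp (g := ev) (f := fun m => (g (ι m)).2.2)
      ((ContinuousLinearMap.contDiff (𝕜 := ℝ) (E := C(Set.Icc (0 : ℝ) 1, ℝ × ℝ × ℝ))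
        (F := ℝ × ℝ × ℝ) _).smoothNear _) hgι.snd.snd
  -- for `m` near `m₀`, the path from `m` to `Q m` solves the integral equation
  have hsol : ∀ᶠ m in 𝓝 m₀, ∃ γ, g (ι m) = (m, m₀.1 - m.1, γ) ∧
      flowEquation X (m, m₀.1 - m.1, γ) = (m, m₀.1 - m.1, 0) := by
    filter_upwards [hιt.eventually hr] with m hm
    have h1 : (g (ι m)).1 = m := congrArg Prod.fst hm
    have h2 : (g (ι m)).2.1 = m₀.1 - m.1 := congrArg (fun z => z.2.1) hm
    have h3 : g (ι m) = (m, m₀.1 - m.1, (g (ι m)).2.2) := Prod.ext h1 (Prod.ext h2 rfl)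
    exact ⟨(g (ι m)).2.2, h3, h3 ▸ hm⟩
  -- along this path `X` is the given field, and `Q` is constant by uniqueness of solutions
  obtain ⟨δ, hδ, hball⟩ := Metric.eventually_nhds_iff_ball.1 hl
  obtain ⟨δ', hδ', hball'⟩ := Metric.eventually_nhds_iff_ball.1 hXl
  have hnear : ∀ᶠ m in 𝓝 m₀, g (ι m) ∈ Metric.ball (m₀, 0, γ₀) (min δ δ') := by
    have : Tendsto (fun m => g (ι m)) (𝓝 m₀) (𝓝 (m₀, 0, γ₀)) := by
      have := hgι.continuousAt.tendsto
      rwa [hι0, hg0] at this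
    exact this (Metric.ball_mem_nhds _ (lt_min hδ hδ'))
  have hconst : ∀ᶠ m in 𝓝 m₀, ∃ γ : C(Set.Icc (0 : ℝ) 1, ℝ × ℝ × ℝ),
      (∀ t, γ t = m + (m₀.1 - m.1) •
        ∫ s in (0 : ℝ)..t, Set.IccExtend zero_le_one (X.comp γ) s) ∧ ∀ t, Q (γ t) = Q m := by
    filter_upwards [hsol, hnear] with m ⟨γ, hγ, hsolγ⟩ hm
    refine ⟨γ, flowEquation_eq_iff.1 hsolγ, fun t => ?_⟩
    rw [hγ] at hm
    simp only [Metric.mem_ball, Prod.dist_eq, max_lt_iff] at hm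
    obtain ⟨-, hε, hγγ⟩ := hm
    have hγt : ∀ t, dist (γ t) m₀ < min δ δ' := fun t =>
      (ContinuousMap.dist_apply_le_dist (f := γ) (g := γ₀) t).trans_lt hγγ
    have hX1 : ∀ t, (X (γ t)).1 = 1 := fun t => by
      have : X (γ t) = jetField lam (γ t) := hball' _ ((hγt t).trans_le (min_le_right _ _))
      rw [this]
      rfl
    have hfst : (γ t).1 = m.1 + (m₀.1 - m.1) * t := by
      have hcomm := ContinuousLinearMap.intervalIntegral_comp_comm
        (ContinuousLinearMap.fst ℝ ℝ (ℝ × ℝ)) ((continuous_extend (X.comp γ)).intervalIntegrable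
        (μ := MeasureTheory.volume) 0 t)
      have hone : ∀ s, (ContinuousLinearMap.fst ℝ ℝ (ℝ × ℝ))
          (Set.IccExtend zero_le_one (X.comp γ) s) = 1 := fun s => hX1 _
      simp only [hone, intervalIntegral.integral_const, sub_zero, smul_eq_mul, mul_one] at hcomm
      rw [flowEquation_eq_iff.1 hsolγ t, Prod.fst_add, Prod.smul_fst, smul_eq_mul]
      congr 2
      exact hcomm.symm
    have hιγ : ι (γ t) = flowEquation X (γ t, (1 - t) * (m₀.1 - m.1), pathTail γ t) := by
      rw [flowEquation_pathTail hsolγ t]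
      simp only [ι, hfst, Prod.mk.injEq, true_and, and_true]
      ring
    have hback : g (ι (γ t)) = (γ t, (1 - t) * (m₀.1 - m.1), pathTail γ t) := by
      rw [hιγ]
      refine hball _ ?_
      change max (dist (γ t) m₀) (max (dist ((1 - (t : ℝ)) * (m₀.1 - m.1)) 0)
        (dist (pathTail γ t) γ₀)) < δ
      refine max_lt ((hγt t).trans_le (min_le_left _ _)) (max_lt ?_ ?_)
      · rw [dist_zero_right] at hε ⊢
        rw [norm_mul]
        refine (mul_le_of_le_one_left (norm_nonneg _) ?_).trans_lt (hε.trans_le (min_le_left _ _))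
        rw [Real.norm_eq_abs, abs_le]
        constructor <;> linarith [t.2.1, t.2.2]
      · rw [ContinuousMap.dist_lt_iff hδ]
        exact fun s => (hγt _).trans_le (min_le_left _ _)
    change ev (g (ι (γ t))).2.2 = ev (g (ι m)).2.2
    rw [hback, hγ]
    change Set.IccExtend zero_le_one γ (t + (1 - t) * ((1 : Set.Icc (0 : ℝ) 1) : ℝ)) = γ 1
    rw [show (t : ℝ) + (1 - t) * ((1 : Set.Icc (0 : ℝ) 1) : ℝ) = 1 by
      rw [Set.Icc.coe_one]; ring]
    exact Set.IccExtend_right _ _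
  refine ⟨Q, hQ, ?_, ?_⟩
  · filter_upwards [hsol] with m ⟨γ, hγ, hsolγ⟩ hm
    change ev (g (ι m)).2.2 = m
    rw [hγ]
    change γ 1 = m
    rw [flowEquation_eq_iff.1 hsolγ 1, hm]
    simp
  have hzero : ∀ᶠ m in 𝓝 m₀, (m₀.1 - m.1) • fderiv ℝ Q m (jetField lam m) = 0 := by
    filter_upwards [hconst, hXl, hQ] with m ⟨γ, hγ, hQγ⟩ hXm hQm
    let c : ℝ → ℝ × ℝ × ℝ := fun t =>
      m + (m₀.1 - m.1) • ∫ s in (0 : ℝ)..t, Set.IccExtend zero_le_one (X.comp γ) s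
    have hcγ : ∀ t (ht : t ∈ Set.Icc (0 : ℝ) 1), c t = γ ⟨t, ht⟩ := fun t ht => (hγ ⟨t, ht⟩).symm
    have hc0 : c 0 = m := by simp [c]
    have hcont := continuous_extend (X.comp γ)
    have hX0 : Set.IccExtend zero_le_one (X.comp γ) 0 = jetField lam m := by
      rw [Set.IccExtend_of_mem _ _ (Set.left_mem_Icc.2 zero_le_one)]
      change X' (γ ⟨0, _⟩) = _
      rw [← hcγ 0 (Set.left_mem_Icc.2 zero_le_one), hc0, hXm]
    have hcd : HasDerivAt c ((m₀.1 - m.1) • jetField lam m) 0 := by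
      have := (intervalIntegral.integral_hasDerivAt_right (hcont.intervalIntegrable
        (μ := MeasureTheory.volume) 0 0)
        hcont.stronglyMeasurable.stronglyMeasurableAtFilter hcont.continuousAt).const_smul
        (m₀.1 - m.1) |>.const_add m
      rwa [hX0] at this
    have hQc : HasDerivWithinAt (fun t => Q (c t)) (fderiv ℝ Q m ((m₀.1 - m.1) • jetField lam m))
        (Set.Icc 0 1) 0 := by
      have hQd : HasFDerivAt Q (fderiv ℝ Q m) (c 0) :=
        hc0.symm ▸ (hQm.differentiableAt (by simp)).hasFDerivAt
      exact (hQd.comp_hasDerivAt 0 hcd).hasDerivWithinAt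
    have hQ0 : HasDerivWithinAt (fun t => Q (c t)) 0 (Set.Icc 0 1) 0 :=
      (hasDerivWithinAt_const (0 : ℝ) (Set.Icc 0 1) (Q m)).congr
        (fun t ht => by rw [hcγ t ht, hQγ]) (by rw [hc0])
    rw [← map_smul]
    exact (uniqueDiffOn_Icc_zero_one 0 (Set.left_mem_Icc.2 zero_le_one)).eq_deriv _ hQc hQ0
  -- the factor `x₀ - x` vanishes only on a set with dense complement
  have hcont := hQ.fderiv_apply hlam.jetField
  filter_upwards [hcont.eventually, eventually_eventually_nhds.2 hzero] with m hm hz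
  by_contra hne
  have hdense : Dense {m : ℝ × ℝ × ℝ | m.1 ≠ m₀.1} :=
    (dense_compl_singleton m₀.1).preimage isOpenMap_fst
  obtain ⟨m', hm', hz', hne'⟩ := ((mem_closure_iff_frequently.1 (hdense m)).and_eventually
    (hz.and (hm.continuousAt.eventually_ne hne))).exists
  exact (smul_ne_zero (sub_ne_zero.2 (Ne.symm hm')) hne') hz'

/-- The integrals of `y'' = lam` whose values on the plane `x = x₀` are `y` and `p`, with their
differentials `dy - p dx` and `dp - lam dx` at the base point. -/
theorem exists_integrals {lam : ℝ × ℝ × ℝ → ℝ} {m₀ : ℝ × ℝ × ℝ} (hlam : SmoothNear lam m₀) :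
    ∃ a b : ℝ × ℝ × ℝ → ℝ, IsIntegralOf lam a m₀ ∧ IsIntegralOf lam b m₀ ∧
      (∀ v, fderiv ℝ a m₀ v = v.2.1 - m₀.2.2 * v.1) ∧
      ∀ v, fderiv ℝ b m₀ v = v.2.2 - lam m₀ * v.1 := by
  obtain ⟨Q, hQ, hQid, hQX⟩ := exists_initialPoint hlam
  have hcomp : ∀ᶠ m in 𝓝 m₀, ∀ v, fderiv ℝ (fun m => (Q m).2.1) m v = (fderiv ℝ Q m v).2.1 ∧
      fderiv ℝ (fun m => (Q m).2.2) m v = (fderiv ℝ Q m v).2.2 := by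
    filter_upwards [hQ] with m hm v
    have h := (hm.differentiableAt (by simp)).hasFDerivAt
    have h1 : HasFDerivAt (fun m => (Q m).2.1) _ m := h.snd.fst
    have h2 : HasFDerivAt (fun m => (Q m).2.2) _ m := h.snd.snd
    rw [h1.fderiv, h2.fderiv]
    exact ⟨rfl, rfl⟩
  have hid : ∀ w : ℝ × ℝ, fderiv ℝ Q m₀ (0, w) = (0, w) := by
    intro w
    have hline : HasDerivAt (fun t : ℝ => m₀ + t • ((0, w) : ℝ × ℝ × ℝ)) (0, w) 0 := by
      simpa using ((hasDerivAt_id (0 : ℝ)).smul_const ((0, w) : ℝ × ℝ × ℝ)).const_add m₀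
    have h0 : m₀ + (0 : ℝ) • ((0, w) : ℝ × ℝ × ℝ) = m₀ := by simp
    have h1 : HasDerivAt (fun t : ℝ => Q (m₀ + t • ((0, w) : ℝ × ℝ × ℝ)))
        (fderiv ℝ Q m₀ (0, w)) 0 :=
      HasFDerivAt.comp_hasDerivAt (l := Q) 0 (h0.symm ▸ hQ.differentiableAt.hasFDerivAt) hline
    have hev : (fun t : ℝ => Q (m₀ + t • ((0, w) : ℝ × ℝ × ℝ))) =ᶠ[𝓝 0]
        fun t => m₀ + t • ((0, w) : ℝ × ℝ × ℝ) := by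
      have ht : Tendsto (fun t : ℝ => m₀ + t • ((0, w) : ℝ × ℝ × ℝ)) (𝓝 0) (𝓝 m₀) := by
        have := hline.continuousAt.tendsto
        rwa [h0] at this
      filter_upwards [ht.eventually hQid] with t ht
      exact ht (by simp)
    exact (h1.congr_of_eventuallyEq hev.symm).unique hline
  have hdec : ∀ v : ℝ × ℝ × ℝ,
      fderiv ℝ Q m₀ v = (0, v.2.1 - m₀.2.2 * v.1, v.2.2 - lam m₀ * v.1) := by
    intro v
    have hv : v = v.1 • jetField lam m₀ + (0, v.2.1 - m₀.2.2 * v.1, v.2.2 - lam m₀ * v.1) := by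
      ext <;> simp [jetField, jetDirection, mul_comm]
    conv_lhs => rw [hv]
    rw [map_add, map_smul, hQX.self_of_nhds, hid, smul_zero, zero_add]
  refine ⟨fun m => (Q m).2.1, fun m => (Q m).2.2, ⟨hQ.snd.fst, ?_⟩, ⟨hQ.snd.snd, ?_⟩, ?_, ?_⟩
  · filter_upwards [hcomp, hQX] with m hm hX
    rw [(hm _).1]
    exact congrArg (fun z => z.2.1) hX
  · filter_upwards [hcomp, hQX] with m hm hX
    rw [(hm _).2]
    exact congrArg (fun z => z.2.2) hX
  · intro v
    rw [(hcomp.self_of_nhds v).1, hdec]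
  · intro v
    rw [(hcomp.self_of_nhds v).2, hdec]

/-! ### Existence of associated equations and their classes -/

theorem IsIntegralOf.congr {lam a b : ℝ × ℝ × ℝ → ℝ} {m₀ : ℝ × ℝ × ℝ} (h : IsIntegralOf lam a m₀)
    (hab : b =ᶠ[𝓝 m₀] a) : IsIntegralOf lam b m₀ := by
  refine ⟨h.1.congr hab, ?_⟩
  filter_upwards [h.2, hab.eventuallyEq_nhds] with m hm he
  rw [he.fderiv_eq, hm]

/-- Functions with independent differentials are local coordinates. -/
theorem isLocalDiffeoNear_of_linearIndependent {a b f : ℝ × ℝ × ℝ → ℝ} {m₀ : ℝ × ℝ × ℝ}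
    (ha : SmoothNear a m₀) (hb : SmoothNear b m₀) (hf : SmoothNear f m₀)
    (hind : LinearIndependent ℝ ![fderiv ℝ a m₀, fderiv ℝ b m₀, fderiv ℝ f m₀]) :
    IsLocalDiffeoNear (fun m => (a m, b m, f m)) m₀ := by
  refine ⟨ha.prodMk (hb.prodMk hf), ?_⟩
  have hfd : fderiv ℝ (fun m => (a m, b m, f m)) m₀ =
      (fderiv ℝ a m₀).prod ((fderiv ℝ b m₀).prod (fderiv ℝ f m₀)) :=
    (ha.differentiableAt.hasFDerivAt.prodMk
      (hb.differentiableAt.hasFDerivAt.prodMk hf.differentiableAt.hasFDerivAt)).fderiv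
  rw [hfd]
  let L : ℝ × ℝ × ℝ →ₗ[ℝ] ℝ × ℝ × ℝ :=
    ((fderiv ℝ a m₀).prod ((fderiv ℝ b m₀).prod (fderiv ℝ f m₀))).toLinearMap
  suffices hL : Function.Surjective L from ⟨LinearMap.injective_iff_surjective.2 hL, hL⟩
  rw [← LinearMap.range_eq_top]
  by_contra hr
  -- a linear form vanishing on the range is a dependence relation between the differentials
  obtain ⟨θ, hθ0, hθ⟩ := Submodule.exists_le_ker_of_lt_top _ (lt_top_iff_ne_top.2 hr)
  have hθv : ∀ v : ℝ × ℝ × ℝ,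
      θ v = v.1 * θ (1, 0, 0) + v.2.1 * θ (0, 1, 0) + v.2.2 * θ (0, 0, 1) := by
    intro v
    have : v = v.1 • (1, 0, 0) + v.2.1 • (0, 1, 0) + v.2.2 • (0, 0, 1) := by ext <;> simp
    conv_lhs => rw [this]
    simp only [map_add, map_smul, smul_eq_mul]
  have h0 := Fintype.linearIndependent_iff.1 hind ![θ (1, 0, 0), θ (0, 1, 0), θ (0, 0, 1)] (by
    refine ContinuousLinearMap.ext fun v => ?_
    have : θ (L v) = 0 := hθ ⟨v, rfl⟩
    rw [hθv] at this
    have h1 : (L v).1 = fderiv ℝ a m₀ v := rfl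
    have h2 : (L v).2.1 = fderiv ℝ b m₀ v := rfl
    have h3 : (L v).2.2 = fderiv ℝ f m₀ v := rfl
    rw [h1, h2, h3] at this
    simp [Fin.sum_univ_three]
    linarith)
  apply hθ0
  refine LinearMap.ext fun v => ?_
  rw [hθv]
  have e0 := h0 0
  have e1 := h0 1
  have e2 := h0 2
  simp only [Matrix.cons_val] at e0 e1 e2
  simp [e0, e1, e2]

/-- Canonical coordinates carry the pair of fields to the vertical field and the field of the
associated ODE. -/
theorem IsAssociatedWith.pairEquiv {lam mu : ℝ × ℝ × ℝ → ℝ} {m₀ : ℝ × ℝ × ℝ} {G : ExplicitODE}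
    (hG : IsAssociatedWith lam mu m₀ G) (hlam : SmoothNear lam m₀) (hmu : SmoothNear mu m₀)
    (hne : lam m₀ ≠ mu m₀) :
    PairEquiv (jetField lam) (jetField mu) m₀ verticalField G.field G.pt := by
  obtain ⟨a, b, f, g, h, ha, hb, hf, hg, hind, -, hh, hgh, h0, hpt, hF⟩ := hG
  have H : IsCanonicalData lam mu a b f h m₀ := ⟨hlam, hmu, hne, ha, hb, hf,
    isLocalDiffeoNear_of_linearIndependent ha.1 hb.1 hf.1 hind, hh,
    hg.congr (EventuallyEq.symm hgh), h0⟩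
  exact ⟨_, H.isLocalDiffeoNear_map, hpt.symm, H.mapsDirection_lam, H.mapsDirection_mu hF⟩

theorem smoothNear_flex_div {h : ℝ × ℝ × ℝ → ℝ} {u : ℝ × ℝ × ℝ} (hh : SmoothNear h u)
    (h0 : pd₂ h u ≠ 0) : SmoothNear (fun u => -(flex h u / pd₂ h u ^ 3)) u := by
  filter_upwards [hh.pd₁, hh.pd₂, hh.pd₁.pd₁, hh.pd₁.pd₂, hh.pd₂.pd₂,
    hh.pd₂.continuousAt.eventually_ne h0] with w h1 h2 h11 h12 h22 hw
  exact (((((h11.mul (h2.pow 2)).sub (((contDiffAt_const.mul h1).mul h2).mul h12)).add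
    (h22.mul (h1.pow 2)))).div (h2.pow 3) (pow_ne_zero 3 hw)).neg

/-- The integrals that restrict to `y` and `p` on the plane `x = x₀` serve as canonical data: with
`da = dp - lam dx`, `db = dg = dy - p dx` and `df = dp - mu dx` at the base point, one has
`h_b = 1` there. -/
theorem exists_isAssociatedWith {lam mu : ℝ × ℝ × ℝ → ℝ} {m₀ : ℝ × ℝ × ℝ}
    (hlam : SmoothNear lam m₀) (hmu : SmoothNear mu m₀) (hne : lam m₀ ≠ mu m₀) :
    ∃ G, IsAssociatedWith lam mu m₀ G := by
  obtain ⟨b, a, hb, ha, hdb, hda⟩ := exists_integrals hlam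
  obtain ⟨g, f, hg, hf, hdg, hdf⟩ := exists_integrals hmu
  have hind : LinearIndependent ℝ ![fderiv ℝ a m₀, fderiv ℝ b m₀, fderiv ℝ f m₀] := by
    rw [Fintype.linearIndependent_iff]
    intro c hc
    have hv : ∀ v : ℝ × ℝ × ℝ, c 0 * (v.2.2 - lam m₀ * v.1) + c 1 * (v.2.1 - m₀.2.2 * v.1) +
        c 2 * (v.2.2 - mu m₀ * v.1) = 0 := by
      intro v
      have := DFunLike.congr_fun hc v
      simpa [Fin.sum_univ_three, hda, hdb, hdf] using this
    have h1 := hv (0, 1, 0)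
    have h2 := hv (0, 0, 1)
    have h3 := hv (1, m₀.2.2, 0)
    simp at h1 h2 h3
    have h0 : c 0 = 0 := by
      have : c 0 * (lam m₀ - mu m₀) = 0 := by linear_combination -h3 - mu m₀ * h2
      exact (mul_eq_zero.1 this).resolve_right (sub_ne_zero.2 hne)
    intro i
    fin_cases i
    · exact h0
    · exact h1
    · simpa [h0] using h2
  have hind' : LinearIndependent ℝ ![fderiv ℝ f m₀, fderiv ℝ g m₀] := by
    rw [LinearIndependent.pair_iff]
    intro s t hst
    have h1 := DFunLike.congr_fun hst (0, 1, 0)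
    have h2 := DFunLike.congr_fun hst (0, 0, 1)
    simp [hdf, hdg] at h1 h2
    exact ⟨h2, h1⟩
  have hT := isLocalDiffeoNear_of_linearIndependent ha.1 hb.1 hf.1 hind
  obtain ⟨S, hS, hS0, hTS, hST⟩ := hT.exists_inverse
  let h : ℝ × ℝ × ℝ → ℝ := fun u => g (S u)
  have hh : SmoothNear h (a m₀, b m₀, f m₀) :=
    SmoothNear.comp (g := g) (f := S) (hS0.symm ▸ hg.1) hS.1
  have hgh : ∀ᶠ m in 𝓝 m₀, g m = h (a m, b m, f m) := by
    filter_upwards [hST] with m hm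
    simp only [h, hm]
  have h0 : pd₂ h (a m₀, b m₀, f m₀) ≠ 0 := by
    have hd := fderiv_fun_comp (g := h) m₀ hh.differentiableAt hT.1.differentiableAt
    rw [← EventuallyEq.fderiv_eq (show g =ᶠ[𝓝 m₀] _ from hgh)] at hd
    have hdv := DFunLike.congr_fun hd (0, 1, 0)
    have hfd := (ha.1.differentiableAt.hasFDerivAt.prodMk
      (hb.1.differentiableAt.hasFDerivAt.prodMk hf.1.differentiableAt.hasFDerivAt)).fderiv
    rw [ContinuousLinearMap.comp_apply, hfd, hdg] at hdv
    simp only [ContinuousLinearMap.prod_apply, hda, hdb, hdf, mul_zero, sub_zero] at hdv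
    rw [pd₂, ← hdv]
    exact one_ne_zero
  have H : IsCanonicalData lam mu a b f h m₀ := ⟨hlam, hmu, hne, ha, hb, hf, hT, hh,
    hg.congr (EventuallyEq.symm hgh), h0⟩
  obtain ⟨R, hR, hR0, -, hRl⟩ := H.isLocalDiffeoNear_map.exists_inverse
  refine ⟨⟨fun w => -(flex h (a (R w), b (R w), f (R w)) / pd₂ h (a (R w), b (R w), f (R w)) ^ 3),
    canonicalCoord h (a m₀, b m₀, f m₀), ?_⟩,
    a, b, f, g, h, ha, hb, hf, hg, hind, hind', hh, hgh, h0, rfl, ?_⟩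
  · have h1 : SmoothNear (fun w => (a (R w), b (R w), f (R w)))
        (canonicalCoord h (a m₀, b m₀, f m₀)) :=
      SmoothNear.comp (g := fun m => (a m, b m, f m)) (f := R) (hR0.symm ▸ hT.1) hR.1
    refine SmoothNear.comp (g := fun u => -(flex h u / pd₂ h u ^ 3))
      (f := fun w => (a (R w), b (R w), f (R w))) ?_ h1
    rw [hR0]
    exact smoothNear_flex_div hh h0
  · have hSt : Tendsto S (𝓝 (a m₀, b m₀, f m₀)) (𝓝 m₀) := by
      have := hS.1.continuousAt.tendsto
      rwa [hS0] at this
    filter_upwards [hTS, hSt.eventually hRl] with u hu hRu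
    rw [hu] at hRu
    simp only [hRu, hu]

namespace HyperbolicODE

theorem root_rev_ne (E : HyperbolicODE) (i : Fin 2) : E.root i.rev E.pt ≠ E.root i E.pt :=
  (E.eventually_root_ne i).self_of_nhds.symm

theorem IsAssociated.pairEquiv {E : HyperbolicODE} {i : Fin 2} {G : ExplicitODE}
    (h : E.IsAssociated i G) :
    PairEquiv (E.field i.rev) (E.field i) E.pt verticalField G.field G.pt :=
  IsAssociatedWith.pairEquiv h (E.smoothNear_root _) (E.smoothNear_root _) (E.root_rev_ne i)

theorem exists_isAssociated (E : HyperbolicODE) (i : Fin 2) : ∃ G, E.IsAssociated i G :=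
  exists_isAssociatedWith (E.smoothNear_root _) (E.smoothNear_root _) (E.root_rev_ne i)

/-- The `i`-th class consists of the ODEs whose pair of fields is equivalent to that of the roots, the
other root coming first. -/
theorem mem_associatedClass_iff (E : HyperbolicODE) (i : Fin 2) (G : ExplicitODE) :
    G ∈ E.associatedClass i ↔
      PairEquiv (E.field i.rev) (E.field i) E.pt verticalField G.field G.pt := by
  constructor
  · rintro ⟨G₀, h₀, h⟩
    exact h₀.pairEquiv.trans ((pointEquivalent_iff _ _).1 h)
  · intro h
    obtain ⟨G₀, h₀⟩ := E.exists_isAssociated i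
    exact ⟨G₀, h₀, (pointEquivalent_iff _ _).2 (h₀.pairEquiv.symm.trans h)⟩

theorem exists_associatedClass_eq (E : HyperbolicODE) (i : Fin 2) :
    ∃ G, E.IsAssociated i G ∧ E.associatedClass i = pointClass G := by
  obtain ⟨G, hG⟩ := E.exists_isAssociated i
  refine ⟨G, hG, Set.ext fun G' => ?_⟩
  rw [mem_associatedClass_iff, pointClass, Set.mem_ofPred_eq, pointEquivalent_iff]
  exact ⟨hG.pairEquiv.symm.trans, hG.pairEquiv.trans⟩

theorem associatedClass_eq_iff (E E' : HyperbolicODE) (i j : Fin 2) :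
    E.associatedClass i = E'.associatedClass j ↔
      PairEquiv (E.field i.rev) (E.field i) E.pt (E'.field j.rev) (E'.field j) E'.pt := by
  constructor
  · intro h
    obtain ⟨G, hG⟩ := E.exists_isAssociated i
    have hG' : G ∈ E'.associatedClass j := h ▸ (E.mem_associatedClass_iff i G).2 hG.pairEquiv
    exact hG.pairEquiv.trans ((E'.mem_associatedClass_iff j G).1 hG').symm
  · intro h
    ext G
    rw [mem_associatedClass_iff, mem_associatedClass_iff]
    exact ⟨h.symm.trans, h.trans⟩

end HyperbolicODE

end

theorem theorem5 (E E' : HyperbolicODE) :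
    (∀ i : Fin 2, ∃ G, E.IsAssociated i G ∧ E.associatedClass i = pointClass G) ∧
    (∀ i : Fin 2, ∃ G, E'.IsAssociated i G ∧ E'.associatedClass i = pointClass G) ∧
    (ContactEquivalent E E' ↔
      ∃ i j : Fin 2, E.associatedClass i = E'.associatedClass j) := by
  refine ⟨E.exists_associatedClass_eq, E'.exists_associatedClass_eq, ?_⟩
  simp only [contactEquivalent_iff, HyperbolicODE.associatedClass_eq_iff]
  constructor
  · rintro ⟨j, h⟩
    exact ⟨1, j.rev, by simpa using h⟩
  · rintro ⟨i, j, h⟩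
    fin_cases i
    · exact ⟨j, h.swap⟩
    · exact ⟨j.rev, by simpa using h⟩
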